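/- Fix $s\in(0,1)$. For $m\ge 0$ and Lebesgue measurable $A,B\subset\mathbb R^m$ put $$L_m(A,B):=\int_A\int_B \frac{dy\,dx}{|x-y|^{m+s}}\in[0,\infty],$$ and for a measurable set $E\subset\mathbb R^m$ and a bounded measurable set $\Omega\subset\mathbb R^m$ let $$\mathcal J_\Omega(E):=L_m(E\cap\Omega,\ \mathbb R^m\setminus E)+L_m(E\setminus\Omega,\ \Omega\setminus E).$$ A measurable set $E\subset\mathbb R^m$ is a minimizer for $\mathcal J$ in $\Omega$ if $\mathcal J_\Omega(E)\le\mathcal J_\Omega(F)$ for every measurable $F\subset\mathbb R^m$ with $F\setminus\Omega=E\setminus\Omega$. It is a local minimizer for $\mathcal J$ in $\mathbb R^m$ if it is a minimizer for $\mathcal J$ in the ball $B_R=\{|x|<R\}$ for every $R>0$. Theorem. Let $n\ge 0$ and let $E\subset\mathbb R^n$ be Lebesgue measurable. Then $E$ is a local minimizer for $\mathcal J$ in $\mathbb R^n$ if and only if $E\times\mathbb R$ is a local minimizer for $\mathcal J$ in $\mathbb R^{n+1}$ (with the same $s$, i.e. with the kernel $|x-y|^{-(n+1)-s}$ in $\mathbb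 R^{n+1}$). -/

import Mathlib

open MeasureTheory

namespace FracPerimeter

/-- The interaction `L(A, B) = ∫∫ χ_A(x) χ_B(y) / |x - y|^(n+s) dx dy`, with values in `[0, ∞]`. -/
noncomputable def interaction (n : ℕ) (s : ℝ) (A B : Set (EuclideanSpace ℝ (Fin n))) : ENNReal :=
  ∫⁻ x in A, ∫⁻ y in B, ENNReal.ofReal (1 / ‖x - y‖ ^ ((n : ℝ) + s))

/-- The local energy integral
`J_Ω(E) = L(E ∩ Ω, Eᶜ) + L(E \ Ω, Eᶜ ∩ Ω)`. -/
noncomputable def localEnergy (n : ℕ) (s : ℝ) (Ω E : Set (EuclideanSpace ℝ (Fin n))) : ENNReal :=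
  interaction n s (E ∩ Ω) Eᶜ + interaction n s (E \ Ω) (Eᶜ ∩ Ω)

/-- `E` is a minimizer for `J` in `Ω`: its energy does not exceed the energy of any
Lebesgue measurable set `F` that coincides with `E` outside `Ω`. -/
def IsMinimizer (n : ℕ) (s : ℝ) (Ω E : Set (EuclideanSpace ℝ (Fin n))) : Prop :=
  ∀ F : Set (EuclideanSpace ℝ (Fin n)), NullMeasurableSet F volume →
    F ∩ Ωᶜ = E ∩ Ωᶜ → localEnergy n s Ω E ≤ localEnergy n s Ω F

/-- `E` is a local minimizer for `J` in `ℝⁿ`: it is a minimizer in every ball `B_R`. -/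
def IsLocalMinimizer (n : ℕ) (s : ℝ) (E : Set (EuclideanSpace ℝ (Fin n))) : Prop :=
  ∀ R : ℝ, 0 < R → IsMinimizer n s (Metric.ball 0 R) E

/-- The cylinder `E × ℝ ⊆ ℝⁿ⁺¹`: the last coordinate is free. -/
def prodLine (n : ℕ) (E : Set (EuclideanSpace ℝ (Fin n))) :
    Set (EuclideanSpace ℝ (Fin (n + 1))) :=
  {x | WithLp.toLp 2 (fun i : Fin n => x i.castSucc) ∈ E}

end FracPerimeter

namespace FracPerimeter
open Set Filter
open scoped ENNReal Topology

/-! Cut `ℝⁿ⁺¹` into horizontal slices. The energy of `G` is a double integral over heights `t`, `t'`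
of the interaction of the slice `G_t` with the complement of `G_{t'}`, for the kernel `(|h|² +
σ²)^(-(n+1+s)/2)` with `σ = t - t'`. Integrating this kernel over `σ` gives a constant multiple of
the kernel `|h|^(-n-s)` of `ℝⁿ` (`exists_lintegral_sliceKern_eq`).

From base to cylinder: for `σ ≠ 0` the slice kernel is a mixture of products of Gaussians, hence
positive definite. Two slices that agree outside a ball therefore interact at least as much as the
average of their self-energies (`sliceEnergy_add_le`). Thus the energy of a competitor dominates the
integral over heights of its slices' energies (`setLIntegral_slice_self_le`), and minimality of `E`
applies to each slice.

From cylinder to base: given a competitor `F` for `E`, use `F` at heights in `(-L, L)` and `E`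
elsewhere. Minimality of the cylinder gives, after division by `2L`, the energy inequality up to the
cost of the transition at heights `±L`. Pairs at height difference `σ` that straddle the slab have
measure at most `min(|σ|, 2L)`, so the normalized cost tends to zero by dominated convergence; the
majorant is integrable because `s < 1`.

All energies lie in `[0, ∞]`. Cancellation is justified by the finite energy of minimizers in balls,
and `energyOn_le_of_energyOn_le` allows balls to be exchanged for cylindrical regions. -/

/-! ### Integrability of the kernel and finite energy of balls -/

/-- The kernel `|h|^{-(m+s)}`. -/
noncomputable def kern (m : ℕ) (s : ℝ) (h : EuclideanSpace ℝ (Fin m)) : ℝ≥0∞ :=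
  ENNReal.ofReal (1 / ‖h‖ ^ ((m : ℝ) + s))

@[fun_prop]
lemma measurable_kern (m : ℕ) (s : ℝ) : Measurable (kern m s) := by
  unfold kern; fun_prop

lemma kern_neg (m : ℕ) (s : ℝ) (h : EuclideanSpace ℝ (Fin m)) : kern m s (-h) = kern m s h := by
  simp [kern]

/-- In polar coordinates the integrand is `r^(-s)` near zero and `r^(-1-s)` at infinity: the first
needs `s < 1`, the second `s > 0`. -/
lemma lintegral_min_norm_mul_kern_lt_top (m : ℕ) {s : ℝ} (hs0 : 0 < s) (hs1 : s < 1) :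
    ∫⁻ h : EuclideanSpace ℝ (Fin m), ENNReal.ofReal (min ‖h‖ 1) * kern m s h < ∞ := by
  rcases Nat.eq_zero_or_pos m with rfl | hm
  · have : ∀ h : EuclideanSpace ℝ (Fin 0), ENNReal.ofReal (min ‖h‖ 1) * kern 0 s h = 0 := by
      intro h; simp [Subsingleton.elim h 0]
    simp_rw [this]
    simp
  have : Nonempty (Fin m) := ⟨⟨0, hm⟩⟩
  have key : Integrable (fun h : EuclideanSpace ℝ (Fin m) =>
      (fun r : ℝ => min r 1 * (1 / r ^ ((m : ℝ) + s))) ‖h‖) volume := by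
    rw [integrable_fun_norm_addHaar (μ := (volume : Measure (EuclideanSpace ℝ (Fin m))))
      (f := fun r : ℝ => min r 1 * (1 / r ^ ((m : ℝ) + s)))]
    rw [finrank_euclideanSpace_fin, ← Ioc_union_Ioi_eq_Ioi (zero_le_one (α := ℝ))]
    have hpow : ∀ r : ℝ, 0 < r → r ^ (m - 1) * (1 / r ^ ((m : ℝ) + s)) = r ^ (-1 - s) := by
      intro r hr
      rw [one_div, ← Real.rpow_neg hr.le, ← Real.rpow_natCast, ← Real.rpow_add hr]
      congr 1
      push_cast [Nat.cast_sub (show 1 ≤ m from hm)]; ring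
    refine IntegrableOn.union ?_ ?_
    · have : IntegrableOn (fun r : ℝ => r ^ (-s)) (Ioc 0 1) := by
        rw [← intervalIntegrable_iff_integrableOn_Ioc_of_le zero_le_one]
        exact intervalIntegral.intervalIntegrable_rpow' (by linarith)
      refine this.congr_fun (fun r hr => ?_) measurableSet_Ioc
      simp only [smul_eq_mul, min_eq_left hr.2]
      rw [mul_left_comm, hpow r hr.1]
      nth_rewrite 2 [← Real.rpow_one r]
      rw [← Real.rpow_add hr.1]; congr 1; ring
    · have : IntegrableOn (fun r : ℝ => r ^ (-1 - s)) (Ioi 1) :=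
        integrableOn_Ioi_rpow_of_lt (by linarith) one_pos
      refine this.congr_fun (fun r hr => ?_) measurableSet_Ioi
      have hr1 : (1 : ℝ) < r := hr
      simp only [smul_eq_mul, min_eq_right hr1.le]
      rw [one_mul, hpow r (by linarith)]
  have h2 := key.lintegral_lt_top
  refine lt_of_eq_of_lt (lintegral_congr fun h => ?_) h2
  rw [kern, ← ENNReal.ofReal_mul (by positivity)]

lemma volume_ball_diff_translate_le (m : ℕ) {R : ℝ} (hR : 0 < R) :
    ∃ C : ℝ≥0∞, C ≠ ∞ ∧ ∀ h : EuclideanSpace ℝ (Fin m),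
      volume {x | x ∈ Metric.ball (0 : EuclideanSpace ℝ (Fin m)) R ∧
        x - h ∉ Metric.ball (0 : EuclideanSpace ℝ (Fin m)) R} ≤ C * ENNReal.ofReal (min ‖h‖ 1) := by
  rcases Nat.eq_zero_or_pos m with rfl | hm
  · refine ⟨0, by simp, fun h => ?_⟩
    have : {x | x ∈ Metric.ball (0 : EuclideanSpace ℝ (Fin 0)) R ∧
        x - h ∉ Metric.ball (0 : EuclideanSpace ℝ (Fin 0)) R} = ∅ := by
      ext x
      simp [Subsingleton.elim h 0]
    rw [this]
    simp
  have : Nonempty (Fin m) := ⟨⟨0, hm⟩⟩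
  set ω := volume (Metric.ball (0 : EuclideanSpace ℝ (Fin m)) 1) with hω
  have hωt : ω ≠ ∞ := measure_ball_lt_top.ne
  have hball : ∀ r : ℝ, 0 ≤ r → volume (Metric.ball (0 : EuclideanSpace ℝ (Fin m)) r)
      = ENNReal.ofReal (r ^ m) * ω := by
    intro r hr
    rw [Measure.addHaar_ball _ _ hr, finrank_euclideanSpace_fin]
  -- One constant for all cases: `m / R` comes from Bernoulli's inequality for small shifts, `1 / R`
  -- serves `R < ‖h‖ ≤ 1`, and `1` covers `‖h‖ ≥ 1`, where the whole ball is a sufficient bound.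
  refine ⟨ENNReal.ofReal (R ^ m * (1 + (m + 1) / R)) * ω,
    ENNReal.mul_ne_top ENNReal.ofReal_ne_top hωt, fun h => ?_⟩
  have real_case : ∀ d : ℝ, d ≤ R ^ m * (1 + (m + 1) / R) * min ‖h‖ 1 →
      ENNReal.ofReal d * ω ≤
      ENNReal.ofReal (R ^ m * (1 + (m + 1) / R)) * ω * ENNReal.ofReal (min ‖h‖ 1) := by
    intro d hd
    rw [mul_right_comm, ← ENNReal.ofReal_mul (by positivity)]
    gcongr
  have hRm : 0 < R ^ m := by positivity
  by_cases h1 : ‖h‖ ≤ R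
  · have hsub : {x | x ∈ Metric.ball (0 : EuclideanSpace ℝ (Fin m)) R ∧
        x - h ∉ Metric.ball (0 : EuclideanSpace ℝ (Fin m)) R} ⊆
        Metric.ball 0 R \ Metric.ball 0 (R - ‖h‖) := by
      rintro x ⟨hx, hx'⟩
      refine ⟨hx, fun hx2 => hx' ?_⟩
      rw [mem_ball_zero_iff] at hx2 ⊢
      linarith [norm_sub_le x h]
    refine (measure_mono hsub).trans ?_
    rw [measure_sdiff (Metric.ball_subset_ball (by linarith [norm_nonneg h]))
      measurableSet_ball.nullMeasurableSet measure_ball_lt_top.ne, hball R hR.le,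
      hball _ (by linarith), ← ENNReal.sub_mul (fun _ _ => hωt),
      ← ENNReal.ofReal_sub _ (pow_nonneg (by linarith) _)]
    apply real_case
    have hb := one_add_mul_le_pow (a := -(‖h‖ / R)) (by
      have : ‖h‖ / R ≤ 1 := (div_le_one hR).2 h1
      linarith) m
    have e : (R - ‖h‖) ^ m = R ^ m * (1 + -(‖h‖ / R)) ^ m := by
      rw [← mul_pow]; congr 1; field_simp; ring
    rw [e]
    have : R ^ m - R ^ m * (1 + -(‖h‖ / R)) ^ m ≤ R ^ m * (m * (‖h‖ / R)) := by nlinarith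
    have h0 : 0 ≤ (1 + -(‖h‖ / R)) ^ m := by
      have : ‖h‖ / R ≤ 1 := (div_le_one hR).2 h1
      exact pow_nonneg (by linarith) _
    rcases le_total ‖h‖ 1 with h2 | h2
    · rw [min_eq_left h2]
      refine this.trans ?_
      rw [mul_assoc]
      refine mul_le_mul_of_nonneg_left ?_ hRm.le
      have : (1 + ((m : ℝ) + 1) / R) * ‖h‖ = m * (‖h‖ / R) + (‖h‖ + ‖h‖ / R) := by
        field_simp; ring
      rw [this]
      have : 0 ≤ ‖h‖ + ‖h‖ / R := by positivity
      linarith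
    · rw [min_eq_right h2, mul_one]
      have : 0 ≤ ((m : ℝ) + 1) / R := by positivity
      nlinarith
  · push Not at h1
    refine (measure_mono (fun x hx => hx.1)).trans ?_
    change volume (Metric.ball (0 : EuclideanSpace ℝ (Fin m)) R) ≤ _
    rw [hball R hR.le]
    apply real_case
    rw [mul_assoc]
    refine le_mul_of_one_le_right hRm.le ?_
    rcases le_total ‖h‖ 1 with h2 | h2
    · rw [min_eq_left h2]
      have h3 : 1 ≤ ‖h‖ / R := (one_le_div hR).2 h1.le
      have : (1 + ((m : ℝ) + 1) / R) * ‖h‖ = ‖h‖ / R + (‖h‖ + m * (‖h‖ / R)) := by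
        field_simp; ring
      rw [this]
      have : 0 ≤ ‖h‖ + m * (‖h‖ / R) := by positivity
      linarith
    · rw [min_eq_right h2, mul_one]
      have : 0 ≤ ((m : ℝ) + 1) / R := by positivity
      linarith

/-- Substituting `h = x - y` and integrating first in `x` leaves the kernel times the volume of the
part of the ball moved in from outside by `h`, which is `O(min(‖h‖, 1))`. -/
lemma interaction_ball_compl_lt_top (m : ℕ) {s : ℝ} (hs0 : 0 < s) (hs1 : s < 1) {R : ℝ}
    (hR : 0 < R) :
    interaction m s (Metric.ball 0 R) (Metric.ball 0 R)ᶜ < ∞ := by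
  set B := Metric.ball (0 : EuclideanSpace ℝ (Fin m)) R with hB
  have hBm : MeasurableSet B := measurableSet_ball
  obtain ⟨C, hC, hCb⟩ := volume_ball_diff_translate_le m hR
  have e1 : interaction m s B Bᶜ =
      ∫⁻ h, ∫⁻ x, ({x | x ∈ B ∧ x - h ∉ B}).indicator (fun _ => kern m s h) x := by
    rw [lintegral_lintegral_swap]
    · rw [interaction, ← lintegral_indicator hBm]
      refine lintegral_congr fun x => ?_
      by_cases hx : x ∈ B
      · rw [indicator_of_mem hx, ← lintegral_indicator hBm.compl]
        refine (lintegral_sub_left_eq_self _ x).symm.trans (lintegral_congr fun h => ?_)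
        by_cases h2 : x - h ∈ B <;> simp [indicator, hx, kern, h2]
      · simp [indicator, hx]
    · refine Measurable.aemeasurable ?_
      have : MeasurableSet {p : EuclideanSpace ℝ (Fin m) × EuclideanSpace ℝ (Fin m) |
          p.2 ∈ B ∧ p.2 - p.1 ∉ B} :=
        (measurable_snd hBm).inter ((measurable_snd.sub measurable_fst) hBm.compl)
      exact Measurable.indicator ((measurable_kern m s).comp measurable_fst) this
  rw [e1]
  have e2 : ∀ h, ∫⁻ x, ({x | x ∈ B ∧ x - h ∉ B}).indicator (fun _ => kern m s h) x ≤
      C * (ENNReal.ofReal (min ‖h‖ 1) * kern m s h) := by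
    intro h
    rw [lintegral_indicator_const, mul_comm, ← mul_assoc]
    · gcongr; exact hCb h
    · exact hBm.inter ((measurable_id.sub_const h) hBm.compl)
  refine (lintegral_mono e2).trans_lt ?_
  rw [lintegral_const_mul' _ _ hC]
  exact ENNReal.mul_lt_top hC.lt_top (lintegral_min_norm_mul_kern_lt_top m hs0 hs1)

/-! ### Energies as integrals over sets of pairs -/

/-- Pairs with at least one entry in `Ω`. -/
def touch {α : Type*} (Ω : Set α) : Set (α × α) := {z | z.1 ∈ Ω ∨ z.2 ∈ Ω}

lemma measurableSet_touch {α : Type*} [MeasurableSpace α] {Ω : Set α} (h : MeasurableSet Ω) :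
    MeasurableSet (touch Ω) :=
  (measurable_fst h).union (measurable_snd h)

/-- The part in `P` of the interaction between `S` and the complement of `T`. -/
noncomputable def energyOn {α : Type*} [MeasureSpace α] (k : α × α → ℝ≥0∞) (P : Set (α × α))
    (S T : Set α) : ℝ≥0∞ :=
  ∫⁻ z in P ∩ S ×ˢ Tᶜ, k z

/-- Pairs that avoid `D` contribute equally to `E` and `G`, so the comparison depends only on `touch
D`. Finiteness on `Q` lets the common part be cancelled; adding the common part on `P` needs no
finiteness. -/
lemma energyOn_le_of_energyOn_le {α : Type*} [MeasureSpace α]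
    {k : α × α → ℝ≥0∞} {P Q : Set (α × α)} {D E G : Set α} (hD : MeasurableSet D)
    (hEG : G ∩ Dᶜ = E ∩ Dᶜ) (hP : touch D ⊆ P) (hQ : touch D ⊆ Q)
    (hfin : energyOn k Q E E ≠ ∞) (hle : energyOn k Q E E ≤ energyOn k Q G G) :
    energyOn k P E E ≤ energyOn k P G G := by
  have hiff : ∀ x, x ∉ D → (x ∈ G ↔ x ∈ E) := by
    intro x hx
    have := Set.ext_iff.1 hEG x
    simpa [hx] using this
  have split : ∀ (P : Set (α × α)) (S : Set α), touch D ⊆ P →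
      energyOn k P S S = energyOn k (touch D) S S + energyOn k (P \ touch D) S S := by
    intro P S h
    rw [energyOn, ← lintegral_inter_add_sdiff k (P ∩ S ×ˢ Sᶜ)
      (measurableSet_touch hD)]
    congr 1
    · rw [energyOn]; congr 2
      ext z; constructor
      · rintro ⟨⟨_, a⟩, b⟩; exact ⟨b, a⟩
      · rintro ⟨b, a⟩; exact ⟨⟨h b, a⟩, b⟩
    · rw [energyOn]; congr 2
      ext z; constructor
      · rintro ⟨⟨c, a⟩, b⟩; exact ⟨⟨c, b⟩, a⟩
      · rintro ⟨⟨c, b⟩, a⟩; exact ⟨⟨c, a⟩, b⟩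
  have same : ∀ P : Set (α × α), energyOn k (P \ touch D) G G = energyOn k (P \ touch D) E E := by
    intro P
    rw [energyOn, energyOn]; congr 2
    ext z
    simp only [mem_inter_iff, Set.mem_sdiff, mem_prod, mem_compl_iff, and_congr_right_iff, touch,
      mem_ofPred_eq, not_or, and_imp]
    intro _ h1 h2
    rw [hiff _ h1, hiff _ h2]
  rw [split Q E hQ] at hle hfin
  rw [split Q G hQ, same Q] at hle
  rw [split P E hP, split P G hP, same P]
  gcongr
  exact (ENNReal.add_le_add_iff_right (ne_top_of_le_ne_top hfin le_add_self)).1 hle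

/-! ### Null sets, and minimality in terms of pairs -/

lemma interaction_congr {n : ℕ} {s : ℝ} {A A' B B' : Set (EuclideanSpace ℝ (Fin n))}
    (hA : A =ᵐ[volume] A') (hB : B =ᵐ[volume] B') :
    interaction n s A B = interaction n s A' B' := by
  rw [interaction, interaction, Measure.restrict_congr_set hA, Measure.restrict_congr_set hB]

lemma localEnergy_congr {n : ℕ} {s : ℝ} {Ω E E' : Set (EuclideanSpace ℝ (Fin n))}
    (h : E =ᵐ[volume] E') : localEnergy n s Ω E = localEnergy n s Ω E' := by
  rw [localEnergy, localEnergy]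
  congr 1
  · exact interaction_congr (h.inter (ae_eq_refl Ω)) h.compl
  · exact interaction_congr (ae_eq_set_sdiff h (ae_eq_refl Ω)) (h.compl.inter (ae_eq_refl Ω))

lemma IsMinimizer.congr {n : ℕ} {s : ℝ} {Ω E E' : Set (EuclideanSpace ℝ (Fin n))}
    (hΩ : MeasurableSet Ω) (hE : NullMeasurableSet E volume)
    (h : E =ᵐ[volume] E') (hmin : IsMinimizer n s Ω E) : IsMinimizer n s Ω E' := by
  intro F hF hFE
  have hae : ((F ∩ Ω) ∪ (E ∩ Ωᶜ) : Set _) =ᵐ[volume] F := by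
    have : F = (F ∩ Ω) ∪ (E' ∩ Ωᶜ) := by rw [← hFE, inter_union_compl]
    conv_rhs => rw [this]
    exact (ae_eq_refl _).union (h.inter (ae_eq_refl _))
  rw [← localEnergy_congr h, ← localEnergy_congr hae]
  refine hmin _ ((hF.inter hΩ.nullMeasurableSet).union (hE.inter hΩ.compl.nullMeasurableSet)) ?_
  ext x
  simp only [mem_inter_iff, mem_union, mem_compl_iff]
  tauto

lemma isLocalMinimizer_congr {n : ℕ} {s : ℝ} {E E' : Set (EuclideanSpace ℝ (Fin n))}
    (hE : NullMeasurableSet E volume) (h : E =ᵐ[volume] E') :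
    IsLocalMinimizer n s E ↔ IsLocalMinimizer n s E' :=
  ⟨fun H R hR => (H R hR).congr measurableSet_ball hE h,
    fun H R hR => (H R hR).congr measurableSet_ball (hE.congr h) h.symm⟩

lemma interaction_eq {n : ℕ} {s : ℝ} {A B : Set (EuclideanSpace ℝ (Fin n))} :
    interaction n s A B = ∫⁻ z in A ×ˢ B, kern n s (z.1 - z.2) := by
  rw [Measure.volume_eq_prod, setLIntegral_prod _ (by fun_prop)]
  rfl

lemma interaction_comm {n : ℕ} {s : ℝ} {A B : Set (EuclideanSpace ℝ (Fin n))}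
    (hA : MeasurableSet A) (hB : MeasurableSet B) :
    interaction n s A B = interaction n s B A := by
  rw [interaction_eq, interaction_eq]
  have h := (Measure.measurePreserving_swap (μ := (volume : Measure (EuclideanSpace ℝ (Fin n))))
    (ν := volume)).setLIntegral_comp_preimage (s := B ×ˢ A)
    (f := fun z => kern n s (z.1 - z.2)) (hB.prod hA) (by fun_prop)
  rw [← Measure.volume_eq_prod] at h
  rw [← h, preimage_swap_prod]
  refine lintegral_congr fun z => ?_
  rw [← kern_neg]; simp

lemma localEnergy_eq {n : ℕ} {s : ℝ} {Ω E : Set (EuclideanSpace ℝ (Fin n))}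
    (hΩ : MeasurableSet Ω) (hE : MeasurableSet E) :
    localEnergy n s Ω E = energyOn (fun z => kern n s (z.1 - z.2)) (touch Ω) E E := by
  rw [localEnergy, interaction_eq, interaction_eq, energyOn, ← lintegral_union]
  · congr 2
    ext z
    simp only [mem_inter_iff, mem_union, mem_prod, Set.mem_sdiff, mem_compl_iff, touch, mem_ofPred_eq]
    tauto
  · exact (hE.diff hΩ).prod (hE.compl.inter hΩ)
  · rw [Set.disjoint_left]
    rintro z ⟨h1, _⟩ ⟨h2, _⟩
    exact h2.2 h1.2

lemma isMinimizer_iff {n : ℕ} {s : ℝ} {Ω E : Set (EuclideanSpace ℝ (Fin n))}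
    (hΩ : MeasurableSet Ω) (hE : MeasurableSet E) :
    IsMinimizer n s Ω E ↔ ∀ F, MeasurableSet F → F ∩ Ωᶜ = E ∩ Ωᶜ →
      energyOn (fun z => kern n s (z.1 - z.2)) (touch Ω) E E ≤
        energyOn (fun z => kern n s (z.1 - z.2)) (touch Ω) F F := by
  constructor
  · intro h F hF hFE
    rw [← localEnergy_eq hΩ hE, ← localEnergy_eq hΩ hF]
    exact h F hF.nullMeasurableSet hFE
  · intro h F hF hFE
    obtain ⟨F', hF', hae⟩ : ∃ F', MeasurableSet F' ∧ F' =ᵐ[volume] F :=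
      ⟨_, measurableSet_toMeasurable _ _, hF.toMeasurable_ae_eq⟩
    -- A competitor must agree with `E` outside `Ω` exactly, not just almost everywhere, so `F'` is
    -- used only inside `Ω`.
    have hae2 : ((F' ∩ Ω) ∪ (E ∩ Ωᶜ) : Set _) =ᵐ[volume] F := by
      have : F = (F ∩ Ω) ∪ (E ∩ Ωᶜ) := by rw [← hFE, inter_union_compl]
      conv_rhs => rw [this]
      exact (hae.inter (ae_eq_refl _)).union (ae_eq_refl _)
    have hm : MeasurableSet ((F' ∩ Ω) ∪ (E ∩ Ωᶜ)) := (hF'.inter hΩ).union (hE.inter hΩ.compl)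
    rw [← localEnergy_congr hae2, localEnergy_eq hΩ hE, localEnergy_eq hΩ hm]
    refine h _ hm ?_
    ext x
    simp only [mem_inter_iff, mem_union, mem_compl_iff]
    tauto

lemma IsMinimizer.energyOn_ball_ne_top {n : ℕ} {s : ℝ} (hs0 : 0 < s) (hs1 : s < 1) {R : ℝ}
    (hR : 0 < R) {E : Set (EuclideanSpace ℝ (Fin n))} (hE : MeasurableSet E)
    (h : IsMinimizer n s (Metric.ball 0 R) E) :
    energyOn (fun z => kern n s (z.1 - z.2)) (touch (Metric.ball 0 R)) E E ≠ ∞ := by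
  rw [← localEnergy_eq measurableSet_ball hE]
  have hm : MeasurableSet (E \ Metric.ball 0 R) := hE.diff measurableSet_ball
  -- Emptying the ball gives a competitor whose energy is at most the interaction of the ball with
  -- its complement.
  refine ne_top_of_le_ne_top ?_ (h (E \ Metric.ball 0 R) hm.nullMeasurableSet ?_)
  · refine ne_top_of_le_ne_top (interaction_ball_compl_lt_top n hs0 hs1 hR).ne ?_
    rw [localEnergy_eq measurableSet_ball hm, interaction_comm measurableSet_ball
      measurableSet_ball.compl, interaction_eq, energyOn]
    refine lintegral_mono_set ?_
    rintro z ⟨h1, h2, h3⟩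
    rcases h1 with h1 | h1
    · exact absurd h1 h2.2
    · exact ⟨h2.2, h1⟩
  · ext x
    simp only [mem_inter_iff, Set.mem_sdiff, mem_compl_iff]
    tauto

/-! ### Positive definiteness of the slice kernel -/

lemma mul_add_mul_le_sq_add_sq (a b : ℝ≥0∞) : a * b + b * a ≤ a * a + b * b := by
  wlog h : a ≤ b generalizing a b
  · have := this b a (le_of_not_ge h)
    rwa [add_comm (a * b), add_comm (a * a)]
  obtain ⟨d, rfl⟩ := exists_add_of_le h
  calc a * (a + d) + (a + d) * a = a * a + (a * a + a * d + a * d) := by ring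
    _ ≤ a * a + (a * a + a * d + a * d) + d * d := le_self_add
    _ = _ := by ring

/-- For each `t` the double integrals factor into products of integrals of `Φ (·, t)` over `a` and
`b`, so the claim is `2AB ≤ A² + B²` integrated against `w`. This is positive definiteness without
subtraction. -/
lemma lintegral_prod_add_le_of_mixture {α β : Type*} [MeasurableSpace α] [MeasurableSpace β]
    {μ : Measure α} {ν : Measure β} [SFinite μ] [SFinite ν] {k : α × α → ℝ≥0∞} {w : β → ℝ≥0∞}
    {Φ : α × β → ℝ≥0∞} (hw : Measurable w) (hΦ : Measurable Φ)
    (hk : ∀ z, k z = ∫⁻ t, w t * (Φ (z.1, t) * Φ (z.2, t)) ∂ν) (a b : Set α) :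
    (∫⁻ z in a ×ˢ b, k z ∂(μ.prod μ)) + ∫⁻ z in b ×ˢ a, k z ∂(μ.prod μ) ≤
      (∫⁻ z in a ×ˢ a, k z ∂(μ.prod μ)) + ∫⁻ z in b ×ˢ b, k z ∂(μ.prod μ) := by
  have key : ∀ a b : Set α, ∫⁻ z in a ×ˢ b, k z ∂(μ.prod μ) =
      ∫⁻ t, w t * ((∫⁻ x in a, Φ (x, t) ∂μ) * ∫⁻ x in b, Φ (x, t) ∂μ) ∂ν := by
    intro a b
    simp_rw [hk]
    rw [lintegral_lintegral_swap (by fun_prop)]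
    refine lintegral_congr fun t => ?_
    rw [lintegral_const_mul _ (by fun_prop), ← Measure.prod_restrict,
      lintegral_prod_mul (f := fun x => Φ (x, t)) (g := fun x => Φ (x, t)) (by fun_prop)
        (by fun_prop)]
  have hm : ∀ a : Set α, Measurable fun t => ∫⁻ x in a, Φ (x, t) ∂μ := by
    intro a
    exact Measurable.lintegral_prod_left' hΦ
  rw [key, key, key, key, ← lintegral_add_left (by have := hm a; have := hm b; fun_prop),
    ← lintegral_add_left (by have := hm a; fun_prop)]
  refine lintegral_mono fun t => ?_
  simp only [← mul_add]
  refine mul_le_mul_right ?_ _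
  exact mul_add_mul_le_sq_add_sq _ _

/-- The kernel `|(h, σ)|^{-(n+1+s)}` of `ℝⁿ⁺¹`, as a function of `h ∈ ℝⁿ` for fixed `σ`. -/
noncomputable def sliceKern (n : ℕ) (s σ : ℝ) (h : EuclideanSpace ℝ (Fin n)) : ℝ≥0∞ :=
  ENNReal.ofReal (1 / (‖h‖ ^ 2 + σ ^ 2) ^ (((n : ℝ) + 1 + s) / 2))

/-- The Gamma integral writes `r^(-p)` as a mixture of `exp(-l r)` with `r = ‖x - y‖² + σ²`, and
each Gaussian in `x - y` is a convolution of two Gaussians of half the variance; `(π / 4l)^(n/2)`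
normalizes the latter. -/
lemma sliceKern_eq_mixture (n : ℕ) {s σ : ℝ} (hs0 : 0 < s) (hσ : σ ≠ 0)
    (x y : EuclideanSpace ℝ (Fin n)) :
    sliceKern n s σ (x - y) = ∫⁻ t : ℝ × EuclideanSpace ℝ (Fin n),
      ENNReal.ofReal (t.1 ^ (((n : ℝ) + 1 + s) / 2 - 1) / Real.Gamma (((n : ℝ) + 1 + s) / 2) *
        Real.exp (-(t.1 * σ ^ 2)) * ((Real.pi / (4 * t.1)) ^ ((n : ℝ) / 2))⁻¹) *
      (ENNReal.ofReal (Real.exp (-(2 * t.1) * ‖x - t.2‖ ^ 2)) *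
        ENNReal.ofReal (Real.exp (-(2 * t.1) * ‖y - t.2‖ ^ 2)))
      ∂((volume.restrict (Ioi 0)).prod volume) := by
  set p := ((n : ℝ) + 1 + s) / 2 with hp
  have hp0 : 0 < p := by positivity
  have hΓ := Real.Gamma_pos_of_pos hp0
  rw [lintegral_prod _ (by fun_prop)]
  have inner : ∀ l ∈ Ioi (0 : ℝ), ∫⁻ z : EuclideanSpace ℝ (Fin n),
      ENNReal.ofReal (l ^ (p - 1) / Real.Gamma p * Real.exp (-(l * σ ^ 2)) *
        ((Real.pi / (4 * l)) ^ ((n : ℝ) / 2))⁻¹) *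
      (ENNReal.ofReal (Real.exp (-(2 * l) * ‖x - z‖ ^ 2)) *
        ENNReal.ofReal (Real.exp (-(2 * l) * ‖y - z‖ ^ 2))) =
      ENNReal.ofReal ((Real.Gamma p)⁻¹ * (l ^ (p - 1) *
        Real.exp (-((‖x - y‖ ^ 2 + σ ^ 2) * l)))) := by
    intro l hl
    have hl : 0 < l := hl
    rw [lintegral_const_mul _ (by fun_prop)]
    -- The parallelogram law completes the square about the midpoint of `x` and `y`.
    have e : ∀ z : EuclideanSpace ℝ (Fin n),
        ENNReal.ofReal (Real.exp (-(2 * l) * ‖x - z‖ ^ 2)) *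
        ENNReal.ofReal (Real.exp (-(2 * l) * ‖y - z‖ ^ 2)) =
        ENNReal.ofReal (Real.exp (-l * ‖x - y‖ ^ 2)) *
        (fun z => ENNReal.ofReal (Real.exp (-(4 * l) * ‖z‖ ^ 2))) (z - (1 / 2 : ℝ) • (x + y)) := by
      intro z
      simp only
      rw [← ENNReal.ofReal_mul (by positivity), ← ENNReal.ofReal_mul (by positivity),
        ← Real.exp_add, ← Real.exp_add]
      congr 2
      have h1 := parallelogram_law_with_norm ℝ (x - z) (y - z)
      have h2 : x - z + (y - z) = (-2 : ℝ) • (z - (1 / 2 : ℝ) • (x + y)) := by module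
      have h3 : x - z - (y - z) = x - y := by abel
      rw [h2, h3, norm_smul] at h1
      norm_num [-smul_add] at h1
      linear_combination (-l) * h1.symm
    simp_rw [e]
    rw [lintegral_const_mul _ (by fun_prop), lintegral_sub_right_eq_self
      (fun z : EuclideanSpace ℝ (Fin n) => ENNReal.ofReal (Real.exp (-(4 * l) * ‖z‖ ^ 2)))]
    have hgauss := GaussianFourier.integral_rexp_neg_mul_sq_norm
      (V := EuclideanSpace ℝ (Fin n)) (b := 4 * l) (by positivity)
    rw [finrank_euclideanSpace_fin] at hgauss
    have hpos : 0 < (Real.pi / (4 * l)) ^ ((n : ℝ) / 2) := by positivity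
    rw [← ofReal_integral_eq_lintegral_ofReal, hgauss, ← ENNReal.ofReal_mul (by positivity),
      ← ENNReal.ofReal_mul (by positivity)]
    · congr 1
      have : Real.exp (-((‖x - y‖ ^ 2 + σ ^ 2) * l)) =
          Real.exp (-(l * σ ^ 2)) * Real.exp (-l * ‖x - y‖ ^ 2) := by
        rw [← Real.exp_add]; congr 1; ring
      rw [this]
      field_simp
    -- A nonintegrable function would have Bochner integral zero by convention, against the positive
    -- value just found.
    · by_contra hni
      rw [integral_undef hni] at hgauss
      exact hpos.ne hgauss
    · exact Eventually.of_forall fun z => by positivity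
  rw [setLIntegral_congr_fun measurableSet_Ioi inner]
  have hr : 0 < ‖x - y‖ ^ 2 + σ ^ 2 := by positivity
  have hint := Real.integral_rpow_mul_exp_neg_mul_Ioi hp0 hr
  rw [← ofReal_integral_eq_lintegral_ofReal, integral_const_mul, hint, sliceKern, ← hp]
  · congr 1
    rw [Real.div_rpow zero_le_one hr.le, Real.one_rpow]
    field_simp
  · refine Integrable.const_mul ?_ _
    by_contra hni
    rw [integral_undef hni] at hint
    have : 0 < (1 / (‖x - y‖ ^ 2 + σ ^ 2)) ^ p * Real.Gamma p := by positivity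
    exact this.ne hint
  · refine (ae_restrict_iff' measurableSet_Ioi).2 (Eventually.of_forall fun l hl => ?_)
    have hl : 0 < l := hl
    simp only [Pi.zero_apply]
    positivity

lemma lintegral_sliceKern_add_le (n : ℕ) {s σ : ℝ} (hs0 : 0 < s) (hσ : σ ≠ 0)
    (a b : Set (EuclideanSpace ℝ (Fin n))) :
    (∫⁻ z in a ×ˢ b, sliceKern n s σ (z.1 - z.2)) + ∫⁻ z in b ×ˢ a, sliceKern n s σ (z.1 - z.2) ≤
    (∫⁻ z in a ×ˢ a, sliceKern n s σ (z.1 - z.2)) +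
      ∫⁻ z in b ×ˢ b, sliceKern n s σ (z.1 - z.2) :=
  lintegral_prod_add_le_of_mixture
    (Φ := fun q : EuclideanSpace ℝ (Fin n) × (ℝ × EuclideanSpace ℝ (Fin n)) =>
      ENNReal.ofReal (Real.exp (-(2 * q.2.1) * ‖q.1 - q.2.2‖ ^ 2)))
    (by fun_prop) (by fun_prop)
    (fun z => sliceKern_eq_mixture n hs0 hσ z.1 z.2) a b

@[fun_prop]
lemma Measurable.sliceKern {α : Type*} [MeasurableSpace α] {n : ℕ} {s : ℝ} {f : α → ℝ}
    {g : α → EuclideanSpace ℝ (Fin n)} (hf : Measurable f) (hg : Measurable g) :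
    Measurable fun x => sliceKern n s (f x) (g x) := by
  unfold FracPerimeter.sliceKern; fun_prop

lemma lintegral_add_add_congr {α : Type*} [MeasurableSpace α] {μ : Measure α}
    {a₁ a₂ a₃ a₄ b₁ b₂ b₃ b₄ : α → ℝ≥0∞} (ha₁ : Measurable a₁) (ha₂ : Measurable a₂)
    (ha₃ : Measurable a₃) (hb₁ : Measurable b₁) (hb₂ : Measurable b₂) (hb₃ : Measurable b₃)
    (h : ∀ x, a₁ x + a₂ x + (a₃ x + a₄ x) = b₁ x + b₂ x + (b₃ x + b₄ x)) :
    ∫⁻ x, a₁ x ∂μ + ∫⁻ x, a₂ x ∂μ + (∫⁻ x, a₃ x ∂μ + ∫⁻ x, a₄ x ∂μ) =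
      ∫⁻ x, b₁ x ∂μ + ∫⁻ x, b₂ x ∂μ + (∫⁻ x, b₃ x ∂μ + ∫⁻ x, b₄ x ∂μ) := by
  rw [← lintegral_add_left ha₁, ← lintegral_add_left ha₃, ← lintegral_add_left hb₁,
    ← lintegral_add_left hb₃, ← lintegral_add_left (by fun_prop),
    ← lintegral_add_left (by fun_prop)]
  exact lintegral_congr h

lemma sliceKern_neg_left (n : ℕ) (s σ : ℝ) (h : EuclideanSpace ℝ (Fin n)) :
    sliceKern n s (-σ) h = sliceKern n s σ h := by
  simp [sliceKern]

lemma lintegral_prod_sliceKern_ne_top (n : ℕ) {s σ : ℝ} (hs0 : 0 < s) (hσ : σ ≠ 0)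
    {a b : Set (EuclideanSpace ℝ (Fin n))} (ha : volume a ≠ ∞) (hb : volume b ≠ ∞) :
    ∫⁻ z in a ×ˢ b, sliceKern n s σ (z.1 - z.2) ≠ ∞ := by
  have hle : ∀ z : EuclideanSpace ℝ (Fin n) × EuclideanSpace ℝ (Fin n),
      sliceKern n s σ (z.1 - z.2) ≤ ENNReal.ofReal (1 / (σ ^ 2) ^ (((n : ℝ) + 1 + s) / 2)) := by
    intro z
    rw [sliceKern]
    gcongr
    exact le_add_of_nonneg_left (by positivity)
  refine ne_top_of_le_ne_top ?_ (lintegral_mono hle)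
  rw [setLIntegral_const, Measure.volume_eq_prod, Measure.prod_prod]
  exact ENNReal.mul_ne_top ENNReal.ofReal_ne_top (ENNReal.mul_ne_top ha hb)

/-- The interaction of two slices at height difference `σ`. -/
noncomputable def sliceEnergy (n : ℕ) (s : ℝ) (B : Set (EuclideanSpace ℝ (Fin n))) (σ : ℝ)
    (S T : Set (EuclideanSpace ℝ (Fin n))) : ℝ≥0∞ :=
  energyOn (fun z => sliceKern n s σ (z.1 - z.2)) (touch B) S T

lemma sliceEnergy_neg (n : ℕ) (s : ℝ) (B : Set (EuclideanSpace ℝ (Fin n))) (σ : ℝ)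
    (S T : Set (EuclideanSpace ℝ (Fin n))) :
    sliceEnergy n s B (-σ) S T = sliceEnergy n s B σ S T := by
  simp only [sliceEnergy, sliceKern_neg_left]

/-- The right side minus the left is the quadratic form of the kernel at `χ_U - χ_V`, which is
supported in `B`. -/
lemma sliceEnergy_add_le (n : ℕ) {s σ : ℝ} (hs0 : 0 < s) (hσ : σ ≠ 0)
    {B U V : Set (EuclideanSpace ℝ (Fin n))} (hB : MeasurableSet B) (hBfin : volume B ≠ ∞)
    (hU : MeasurableSet U) (hV : MeasurableSet V) (hUV : U ∩ Bᶜ = V ∩ Bᶜ) :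
    sliceEnergy n s B σ U U + sliceEnergy n s B σ V V ≤
      sliceEnergy n s B σ U V + sliceEnergy n s B σ V U := by
  have hiff : ∀ x, x ∉ B → (x ∈ U ↔ x ∈ V) := by
    intro x hx
    have := Set.ext_iff.1 hUV x
    simpa [hx] using this
  have ha : volume (U \ V) ≠ ∞ := by
    refine ne_top_of_le_ne_top hBfin (measure_mono fun x hx => ?_)
    by_contra hxB
    exact hx.2 ((hiff x hxB).1 hx.1)
  have hb : volume (V \ U) ≠ ∞ := by
    refine ne_top_of_le_ne_top hBfin (measure_mono fun x hx => ?_)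
    by_contra hxB
    exact hx.2 ((hiff x hxB).2 hx.1)
  have hQ := lintegral_sliceKern_add_le n hs0 hσ (U \ V) (V \ U)
  have hab := lintegral_prod_sliceKern_ne_top n hs0 hσ ha hb
  have hba := lintegral_prod_sliceKern_ne_top n hs0 hσ hb ha
  have hBm := measurableSet_touch hB
  have hk : Measurable fun z : EuclideanSpace ℝ (Fin n) × EuclideanSpace ℝ (Fin n) =>
      sliceKern n s σ (z.1 - z.2) := by fun_prop
  have hUdV := hU.diff hV
  have hVdU := hV.diff hU
  -- The expanded quadratic form with its negative terms moved across. These cross terms are finite,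
  -- since the kernel is bounded for `σ ≠ 0` and both differences lie in `B`, so they can be
  -- cancelled at the end.
  have identity : sliceEnergy n s B σ U V + sliceEnergy n s B σ V U +
      ((∫⁻ z in (U \ V) ×ˢ (V \ U), sliceKern n s σ (z.1 - z.2)) +
        ∫⁻ z in (V \ U) ×ˢ (U \ V), sliceKern n s σ (z.1 - z.2)) =
      sliceEnergy n s B σ U U + sliceEnergy n s B σ V V +
      ((∫⁻ z in (U \ V) ×ˢ (U \ V), sliceKern n s σ (z.1 - z.2)) +
        ∫⁻ z in (V \ U) ×ˢ (V \ U), sliceKern n s σ (z.1 - z.2)) := by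
    have m1 := hk.indicator (hBm.inter (hU.prod hV.compl))
    have m2 := hk.indicator (hBm.inter (hV.prod hU.compl))
    have m3 := hk.indicator (hBm.inter (hU.prod hU.compl))
    have m4 := hk.indicator (hBm.inter (hV.prod hV.compl))
    have m5 := hk.indicator (hUdV.prod hVdU)
    have m6 := hk.indicator (hUdV.prod hUdV)
    simp only [sliceEnergy, energyOn]
    rw [← lintegral_indicator (hBm.inter (hU.prod hV.compl)),
      ← lintegral_indicator (hBm.inter (hV.prod hU.compl)),
      ← lintegral_indicator (hBm.inter (hU.prod hU.compl)),
      ← lintegral_indicator (hBm.inter (hV.prod hV.compl)),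
      ← lintegral_indicator (hUdV.prod hVdU), ← lintegral_indicator (hVdU.prod hUdV),
      ← lintegral_indicator (hUdV.prod hUdV), ← lintegral_indicator (hVdU.prod hVdU)]
    refine lintegral_add_add_congr m1 m2 m5 m3 m4 m6 fun z => ?_
    have h1 := hiff z.1
    have h2 := hiff z.2
    simp only [indicator, mem_inter_iff, mem_prod, mem_compl_iff, Set.mem_sdiff, touch,
      mem_ofPred_eq]
    by_cases a1 : z.1 ∈ U <;> by_cases a2 : z.1 ∈ V <;> by_cases a3 : z.2 ∈ U <;>
      by_cases a4 : z.2 ∈ V <;> by_cases a5 : z.1 ∈ B <;> by_cases a6 : z.2 ∈ B <;>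
      simp_all
  have hfin : ((∫⁻ z in (U \ V) ×ˢ (V \ U), sliceKern n s σ (z.1 - z.2)) +
        ∫⁻ z in (V \ U) ×ˢ (U \ V), sliceKern n s σ (z.1 - z.2)) ≠ ∞ :=
    ENNReal.add_ne_top.2 ⟨hab, hba⟩
  refine (ENNReal.add_le_add_iff_right hfin).1 ?_
  rw [identity]
  gcongr

/-! ### Integration over the height difference, and mixed slices -/

lemma exists_lintegral_sliceKern_eq (n : ℕ) {s : ℝ} (hs0 : 0 < s) :
    ∃ c : ℝ≥0∞, c ≠ 0 ∧ c ≠ ∞ ∧ ∀ h : EuclideanSpace ℝ (Fin n), h ≠ 0 →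
      ∫⁻ σ, sliceKern n s σ h = c * kern n s h := by
  set p := ((n : ℝ) + 1 + s) / 2 with hp
  refine ⟨∫⁻ τ : ℝ, ENNReal.ofReal (1 / (1 + τ ^ 2) ^ p), ?_, ?_, fun h hh => ?_⟩
  · refine ((lintegral_pos_iff_support (by fun_prop)).2 ?_).ne'
    have : (Function.support fun τ : ℝ => ENNReal.ofReal (1 / (1 + τ ^ 2) ^ p)) = univ := by
      ext τ
      have : 0 < 1 / (1 + τ ^ 2) ^ p := by positivity
      simpa [-one_div] using this
    rw [this]
    simp
  · have := (integrable_rpow_neg_one_add_norm_sq (E := ℝ) (r := (n : ℝ) + 1 + s)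
      (μ := volume) (by rw [Module.finrank_self]; push_cast; linarith [n.cast_nonneg (α := ℝ)])).lintegral_lt_top
    refine (lt_of_eq_of_lt (lintegral_congr fun τ => ?_) this).ne
    rw [Real.norm_eq_abs, sq_abs, neg_div, Real.rpow_neg (by positivity), one_div]
  · have hr : 0 < ‖h‖ := norm_pos_iff.2 hh
    -- Scaling `σ = ‖h‖ τ` extracts `‖h‖^(1 - (n+1+s))` and leaves the constant.
    conv_lhs => rw [← Real.smul_map_volume_mul_left hr.ne']
    rw [lintegral_smul_measure, lintegral_map (by unfold sliceKern; fun_prop) (by fun_prop)]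
    have e : ∀ τ : ℝ, sliceKern n s (‖h‖ * τ) h =
        ENNReal.ofReal (‖h‖ ^ (-((n : ℝ) + 1 + s))) * ENNReal.ofReal (1 / (1 + τ ^ 2) ^ p) := by
      intro τ
      rw [sliceKern, ← hp, ← ENNReal.ofReal_mul (by positivity)]
      congr 1
      have : ‖h‖ ^ 2 + (‖h‖ * τ) ^ 2 = ‖h‖ ^ 2 * (1 + τ ^ 2) := by ring
      rw [this, Real.mul_rpow (by positivity) (by positivity), ← Real.rpow_natCast,
        ← Real.rpow_mul hr.le, Real.rpow_neg hr.le]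
      have : ((2 : ℕ) : ℝ) * p = (n : ℝ) + 1 + s := by rw [hp]; push_cast; ring
      rw [this]
      field_simp
    simp_rw [e]
    rw [lintegral_const_mul _ (by fun_prop), smul_eq_mul, ← mul_assoc,
      ← ENNReal.ofReal_mul (by positivity), mul_comm, kern, abs_of_pos hr]
    congr 2
    nth_rewrite 1 [← Real.rpow_one ‖h‖]
    rw [← Real.rpow_add hr, one_div, ← Real.rpow_neg hr.le]
    congr 1; ring

lemma lintegral_sliceEnergy_self {n : ℕ} {s : ℝ} {c : ℝ≥0∞} (hc : c ≠ ∞)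
    (hcs : ∀ h : EuclideanSpace ℝ (Fin n), h ≠ 0 → ∫⁻ σ, sliceKern n s σ h = c * kern n s h)
    {B S : Set (EuclideanSpace ℝ (Fin n))} (hB : MeasurableSet B) (hS : MeasurableSet S) :
    ∫⁻ σ, sliceEnergy n s B σ S S =
      c * energyOn (fun z => kern n s (z.1 - z.2)) (touch B) S S := by
  simp only [sliceEnergy, energyOn]
  rw [lintegral_lintegral_swap (by fun_prop), ← lintegral_const_mul' _ _ hc]
  refine setLIntegral_congr_fun ((measurableSet_touch hB).inter (hS.prod hS.compl)) fun z hz => ?_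
  -- A point of `S` and a point of its complement are distinct, so the excluded value `h = 0` does
  -- not occur.
  refine hcs _ fun h0 => ?_
  rw [sub_eq_zero] at h0
  exact hz.2.2 (h0 ▸ hz.2.1)

@[fun_prop]
lemma measurable_sliceEnergy (n : ℕ) (s : ℝ) (B S T : Set (EuclideanSpace ℝ (Fin n))) :
    Measurable fun σ => sliceEnergy n s B σ S T := by
  unfold sliceEnergy energyOn
  fun_prop

lemma lintegral_univ_prod_sliceKern (n : ℕ) (s σ : ℝ) (B : Set (EuclideanSpace ℝ (Fin n))) :
    ∫⁻ z in univ ×ˢ B, sliceKern n s σ (z.1 - z.2) = volume B * ∫⁻ h, sliceKern n s σ h := by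
  rw [Measure.volume_eq_prod, setLIntegral_prod_symm _ (by fun_prop)]
  simp only [Measure.restrict_univ]
  simp_rw [lintegral_sub_right_eq_self (fun h => sliceKern n s σ h)]
  rw [setLIntegral_const, mul_comm]

lemma lintegral_prod_univ_sliceKern (n : ℕ) (s σ : ℝ) (B : Set (EuclideanSpace ℝ (Fin n))) :
    ∫⁻ z in B ×ˢ univ, sliceKern n s σ (z.1 - z.2) = volume B * ∫⁻ h, sliceKern n s σ h := by
  rw [Measure.volume_eq_prod, setLIntegral_prod _ (by fun_prop)]
  simp only [Measure.restrict_univ]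
  simp_rw [lintegral_sub_left_eq_self (fun h => sliceKern n s σ h)]
  rw [setLIntegral_const, mul_comm]

/-- A point outside `E` is either outside `F` or in `F \ E`, hence in `B`; the latter pairs cost at
most the whole kernel mass per point of `B`. -/
lemma sliceEnergy_left_le (n : ℕ) (s σ : ℝ) {B E F : Set (EuclideanSpace ℝ (Fin n))}
    (hEF : F ∩ Bᶜ = E ∩ Bᶜ) :
    sliceEnergy n s B σ F E ≤
      sliceEnergy n s B σ F F + volume B * ∫⁻ h, sliceKern n s σ h := by
  rw [← lintegral_univ_prod_sliceKern]
  refine le_trans (lintegral_mono_set ?_) (lintegral_union_le _ _ _)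
  rintro z ⟨h1, h2, h3⟩
  by_cases h4 : z.2 ∈ F
  · refine Or.inr ⟨trivial, ?_⟩
    by_contra h5
    exact h3 ((Set.ext_iff.1 hEF z.2).1 ⟨h4, h5⟩).1
  · exact Or.inl ⟨h1, h2, h4⟩

lemma sliceEnergy_right_le (n : ℕ) (s σ : ℝ) {B E F : Set (EuclideanSpace ℝ (Fin n))}
    (hEF : F ∩ Bᶜ = E ∩ Bᶜ) :
    sliceEnergy n s B σ E F ≤
      sliceEnergy n s B σ F F + volume B * ∫⁻ h, sliceKern n s σ h := by
  rw [← lintegral_prod_univ_sliceKern]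
  refine le_trans (lintegral_mono_set ?_) (lintegral_union_le _ _ _)
  rintro z ⟨h1, h2, h3⟩
  by_cases h4 : z.1 ∈ F
  · exact Or.inl ⟨h1, h4, h3⟩
  · refine Or.inr ⟨?_, trivial⟩
    by_contra h5
    exact h4 ((Set.ext_iff.1 hEF z.1).2 ⟨h2, h5⟩).1

/-! ### Slicing the energy in one more dimension -/

/-- The identification of `ℝⁿ⁺¹` with `ℝⁿ × ℝ`, splitting off the last coordinate. -/
noncomputable def splitLast (n : ℕ) :
    EuclideanSpace ℝ (Fin (n + 1)) ≃ᵐ EuclideanSpace ℝ (Fin n) × ℝ :=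
  (MeasurableEquiv.toLp 2 (Fin (n + 1) → ℝ)).symm.trans <|
    (MeasurableEquiv.piFinSuccAbove (fun _ => ℝ) (Fin.last n)).trans <|
      MeasurableEquiv.prodComm.trans <|
        (MeasurableEquiv.toLp 2 (Fin n → ℝ)).prodCongr (MeasurableEquiv.refl ℝ)

lemma splitLast_apply (n : ℕ) (x : EuclideanSpace ℝ (Fin (n + 1))) :
    splitLast n x = (WithLp.toLp 2 (fun i : Fin n => x i.castSucc), x (Fin.last n)) := by
  refine Prod.ext ?_ rfl
  change WithLp.toLp 2 (fun i : Fin n => x ((Fin.last n).succAbove i)) = _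
  simp

lemma measurePreserving_splitLast (n : ℕ) : MeasurePreserving (splitLast n) := by
  refine MeasurePreserving.trans (e' := (MeasurableEquiv.piFinSuccAbove (fun _ => ℝ)
    (Fin.last n)).trans <| MeasurableEquiv.prodComm.trans <|
        (MeasurableEquiv.toLp 2 (Fin n → ℝ)).prodCongr (MeasurableEquiv.refl ℝ))
    (PiLp.volume_preserving_ofLp _) ?_
  refine (volume_preserving_piFinSuccAbove (fun _ => ℝ) (Fin.last n)).trans ?_
  refine Measure.measurePreserving_swap.trans (μb := volume.prod volume)
    (e := MeasurableEquiv.prodComm) ?_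
  exact (PiLp.volume_preserving_toLp _).prod (MeasurePreserving.id _)

lemma norm_sq_splitLast (n : ℕ) (x : EuclideanSpace ℝ (Fin (n + 1))) :
    ‖(splitLast n x).1‖ ^ 2 + (splitLast n x).2 ^ 2 = ‖x‖ ^ 2 := by
  rw [splitLast_apply, EuclideanSpace.norm_sq_eq, EuclideanSpace.norm_sq_eq, Fin.sum_univ_castSucc]
  simp

lemma splitLast_sub (n : ℕ) (x y : EuclideanSpace ℝ (Fin (n + 1))) :
    splitLast n (x - y) = splitLast n x - splitLast n y := by
  simp only [splitLast_apply]
  rfl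

lemma kern_succ_eq (n : ℕ) (s : ℝ) (x : EuclideanSpace ℝ (Fin (n + 1))) :
    kern (n + 1) s x = sliceKern n s (splitLast n x).2 (splitLast n x).1 := by
  rw [kern, sliceKern, norm_sq_splitLast, ← Real.rpow_natCast, ← Real.rpow_mul (norm_nonneg _)]
  congr 3
  push_cast; ring

lemma prodLine_eq (n : ℕ) (E : Set (EuclideanSpace ℝ (Fin n))) :
    prodLine n E = splitLast n ⁻¹' (E ×ˢ univ) := by
  ext x
  simp [prodLine, splitLast_apply]

lemma lintegral_prod_prod_eq {α β : Type*} [MeasureSpace α] [MeasureSpace β]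
    [SigmaFinite (volume : Measure α)] [SigmaFinite (volume : Measure β)]
    {F : (α × β) × (α × β) → ℝ≥0∞} (hF : Measurable F) :
    ∫⁻ z, F z = ∫⁻ τ : β × β, ∫⁻ w : α × α, F ((w.1, τ.1), (w.2, τ.2)) := by
  simp only [Measure.volume_eq_prod]
  rw [lintegral_prod _ (by fun_prop), lintegral_prod_symm _ (by fun_prop),
    lintegral_prod _ (by fun_prop)]
  refine lintegral_congr fun t => ?_
  have h (x : α) : ∫⁻ w, F ((x, t), w) ∂((volume : Measure α).prod (volume : Measure β)) =
      ∫⁻ t', ∫⁻ x', F ((x, t), (x', t')) := lintegral_prod_symm _ (by fun_prop)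
  simp_rw [h]
  rw [lintegral_lintegral_swap (by fun_prop)]
  refine lintegral_congr fun t' => ?_
  rw [lintegral_prod _ (by fun_prop)]

/-- Horizontal slice at height `t`. -/
def slice (n : ℕ) (G : Set (EuclideanSpace ℝ (Fin (n + 1)))) (t : ℝ) :
    Set (EuclideanSpace ℝ (Fin n)) :=
  {x | (splitLast n).symm (x, t) ∈ G}

lemma measurableSet_slice {n : ℕ} {G : Set (EuclideanSpace ℝ (Fin (n + 1)))}
    (hG : MeasurableSet G) (t : ℝ) : MeasurableSet (slice n G t) :=
  ((splitLast n).symm.measurable.comp (measurable_id.prodMk measurable_const)) hG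

/-- Pairs of points of `ℝⁿ⁺¹` touching `B` horizontally and `I` vertically. -/
def touchProd (n : ℕ) (B : Set (EuclideanSpace ℝ (Fin n))) (I : Set ℝ) :
    Set (EuclideanSpace ℝ (Fin (n + 1)) × EuclideanSpace ℝ (Fin (n + 1))) :=
  {z | ((splitLast n z.1).1, (splitLast n z.2).1) ∈ touch B ∧
    ((splitLast n z.1).2, (splitLast n z.2).2) ∈ touch I}

lemma energyOn_touchProd {n : ℕ} {s : ℝ} {B : Set (EuclideanSpace ℝ (Fin n))} {I : Set ℝ}
    {G : Set (EuclideanSpace ℝ (Fin (n + 1)))} (hB : MeasurableSet B) (hI : MeasurableSet I)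
    (hG : MeasurableSet G) :
    energyOn (fun z => kern (n + 1) s (z.1 - z.2)) (touchProd n B I) G G =
      ∫⁻ τ in touch I, sliceEnergy n s B (τ.1 - τ.2) (slice n G τ.1) (slice n G τ.2) := by
  have hBm := measurableSet_touch hB
  have hIm := measurableSet_touch hI
  have hPm : MeasurableSet (touchProd n B I ∩ G ×ˢ Gᶜ) := by
    refine MeasurableSet.inter (MeasurableSet.inter ?_ ?_) (hG.prod hG.compl)
    · exact (by fun_prop : Measurable fun z : EuclideanSpace ℝ (Fin (n + 1)) ×
        EuclideanSpace ℝ (Fin (n + 1)) => ((splitLast n z.1).1, (splitLast n z.2).1)) hBm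
    · exact (by fun_prop : Measurable fun z : EuclideanSpace ℝ (Fin (n + 1)) ×
        EuclideanSpace ℝ (Fin (n + 1)) => ((splitLast n z.1).2, (splitLast n z.2).2)) hIm
  have hsymm := (measurePreserving_splitLast n).symm
  have hmp := hsymm.prod hsymm
  have hemb := ((splitLast n).symm.prodCongr (splitLast n).symm).measurableEmbedding
  rw [energyOn, ← lintegral_indicator hPm, ← lintegral_indicator hIm]
  have hmeas : Measurable ((touchProd n B I ∩ G ×ˢ Gᶜ).indicator
      fun z => kern (n + 1) s (z.1 - z.2)) := Measurable.indicator (by fun_prop) hPm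
  rw [Measure.volume_eq_prod, ← hmp.lintegral_comp hmeas, ← Measure.volume_eq_prod,
    lintegral_prod_prod_eq (by exact hmeas.comp hmp.measurable)]
  refine lintegral_congr fun τ => ?_
  by_cases hτ : τ ∈ touch I
  · rw [indicator_of_mem hτ, sliceEnergy, energyOn, ← lintegral_indicator (hBm.inter
      ((measurableSet_slice hG _).prod (measurableSet_slice hG _).compl))]
    refine lintegral_congr fun w => ?_
    have hτ' : (τ.1, τ.2) ∈ touch I := hτ
    by_cases hw : w ∈ touch B ∩ slice n G τ.1 ×ˢ (slice n G τ.2)ᶜ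
    · rw [indicator_of_mem hw, indicator_of_mem]
      · simp [kern_succ_eq, splitLast_sub]
      · refine ⟨⟨?_, ?_⟩, hw.2⟩
        · simpa using hw.1
        · simpa using hτ
    · rw [indicator_of_notMem hw, indicator_of_notMem]
      rintro ⟨⟨h1, _⟩, h2⟩
      exact hw ⟨by simpa using h1, h2⟩
  · rw [indicator_of_notMem hτ]
    refine (lintegral_congr fun w => ?_).trans lintegral_zero
    refine indicator_of_notMem ?_ _
    rintro ⟨⟨_, h1⟩, _⟩
    exact hτ (by simpa using h1)

lemma measurable_sliceEnergy_slice {n : ℕ} {s : ℝ} {B : Set (EuclideanSpace ℝ (Fin n))}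
    {G G' : Set (EuclideanSpace ℝ (Fin (n + 1)))} (hB : MeasurableSet B)
    (hG : MeasurableSet G) (hG' : MeasurableSet G') {f g h : ℝ × ℝ → ℝ} (hf : Measurable f)
    (hg : Measurable g) (hh : Measurable h) :
    Measurable fun τ : ℝ × ℝ => sliceEnergy n s B (f τ) (slice n G (g τ)) (slice n G' (h τ)) := by
  have hBm := measurableSet_touch hB
  have e : ∀ τ : ℝ × ℝ, sliceEnergy n s B (f τ) (slice n G (g τ)) (slice n G' (h τ)) =
      ∫⁻ w, ({q : (ℝ × ℝ) × (EuclideanSpace ℝ (Fin n) × EuclideanSpace ℝ (Fin n)) |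
        q.2 ∈ touch B ∧ (splitLast n).symm (q.2.1, g q.1) ∈ G ∧
          (splitLast n).symm (q.2.2, h q.1) ∈ G'ᶜ}).indicator
            (fun q => sliceKern n s (f q.1) (q.2.1 - q.2.2)) (τ, w) := by
    intro τ
    rw [sliceEnergy, energyOn, ← lintegral_indicator (hBm.inter
      ((measurableSet_slice hG _).prod (measurableSet_slice hG' _).compl))]
    rfl
  simp_rw [e]
  refine Measurable.lintegral_prod_right' (Measurable.indicator (by fun_prop) ?_)
  refine MeasurableSet.inter (measurable_snd hBm) (MeasurableSet.inter ?_ ?_)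
  · exact (by fun_prop : Measurable fun q : (ℝ × ℝ) × (EuclideanSpace ℝ (Fin n) ×
      EuclideanSpace ℝ (Fin n)) => (splitLast n).symm (q.2.1, g q.1)) hG
  · exact (by fun_prop : Measurable fun q : (ℝ × ℝ) × (EuclideanSpace ℝ (Fin n) ×
      EuclideanSpace ℝ (Fin n)) => (splitLast n).symm (q.2.2, h q.1)) hG'.compl

/-- This is the kernel estimate in dimension `n + 1`, because `|σ| ≤ ‖(h, σ)‖`. -/
lemma lintegral_min_mul_lintegral_sliceKern_lt_top (n : ℕ) {s : ℝ} (hs0 : 0 < s) (hs1 : s < 1) :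
    ∫⁻ σ : ℝ, ENNReal.ofReal (min |σ| 1) * ∫⁻ h, sliceKern n s σ h < ∞ := by
  refine lt_of_le_of_lt ?_ (lintegral_min_norm_mul_kern_lt_top (n + 1) hs0 hs1)
  have hsymm := (measurePreserving_splitLast n).symm
  rw [← hsymm.lintegral_comp (by fun_prop), Measure.volume_eq_prod,
    lintegral_prod_symm _ (by fun_prop)]
  refine lintegral_mono fun σ => ?_
  rw [← lintegral_const_mul' _ _ ENNReal.ofReal_ne_top]
  refine lintegral_mono fun h => ?_
  simp only [kern_succ_eq, MeasurableEquiv.apply_symm_apply]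
  gcongr
  have := norm_sq_splitLast n ((splitLast n).symm (h, σ))
  rw [MeasurableEquiv.apply_symm_apply] at this
  exact abs_le_of_sq_le_sq (by simp only at this; nlinarith [sq_nonneg ‖h‖]) (norm_nonneg _)

lemma slice_prodLine (n : ℕ) (E : Set (EuclideanSpace ℝ (Fin n))) (t : ℝ) :
    slice n (prodLine n E) t = E := by
  ext x
  simp [slice, prodLine_eq]

lemma measurableSet_prodLine {n : ℕ} {E : Set (EuclideanSpace ℝ (Fin n))} (hE : MeasurableSet E) :
    MeasurableSet (prodLine n E) := by
  rw [prodLine_eq]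
  exact (splitLast n).measurable (hE.prod MeasurableSet.univ)

/-! ### Pairs of heights -/

lemma setLIntegral_prod_univ_sub {f : ℝ → ℝ≥0∞} (hf : Measurable f) (I : Set ℝ) :
    ∫⁻ τ in I ×ˢ univ, f (τ.1 - τ.2) = volume I * ∫⁻ σ, f σ := by
  rw [Measure.volume_eq_prod, setLIntegral_prod _ (by fun_prop)]
  simp only [Measure.restrict_univ]
  simp_rw [lintegral_sub_left_eq_self f]
  rw [setLIntegral_const, mul_comm]

lemma setLIntegral_univ_prod_sub {f : ℝ → ℝ≥0∞} (hf : Measurable f) (I : Set ℝ) :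
    ∫⁻ τ in univ ×ˢ I, f (τ.1 - τ.2) = volume I * ∫⁻ σ, f σ := by
  rw [Measure.volume_eq_prod, setLIntegral_prod_symm _ (by fun_prop)]
  simp only [Measure.restrict_univ]
  simp_rw [lintegral_sub_right_eq_self f]
  rw [setLIntegral_const, mul_comm]

lemma setLIntegral_swap {f : ℝ × ℝ → ℝ≥0∞} (hf : Measurable f) {A : Set (ℝ × ℝ)}
    (hA : MeasurableSet A) :
    ∫⁻ τ in A, f τ = ∫⁻ τ in Prod.swap ⁻¹' A, f τ.swap := by
  have h := (Measure.measurePreserving_swap (μ := (volume : Measure ℝ))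
    (ν := (volume : Measure ℝ))).setLIntegral_comp_preimage hA hf
  exact h.symm

lemma ae_fst_ne_snd : ∀ᵐ τ : ℝ × ℝ, τ.1 ≠ τ.2 := by
  have hm : MeasurableSet {τ : ℝ × ℝ | τ.1 = τ.2} :=
    measurableSet_eq_fun measurable_fst measurable_snd
  have h0 : volume {τ : ℝ × ℝ | τ.1 = τ.2} = 0 := by
    rw [Measure.volume_eq_prod, Measure.measure_prod_null hm]
    refine Eventually.of_forall fun t => ?_
    have : Prod.mk t ⁻¹' {τ : ℝ × ℝ | τ.1 = τ.2} = {t} := by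
      ext x; simp [eq_comm]
    simp only [this]; simp
  rw [ae_iff]
  simpa using h0

lemma setLIntegral_touch_sub_ne_top {f : ℝ → ℝ≥0∞} (hf : Measurable f) {I : Set ℝ}
    (hI : volume I ≠ ∞) (hfin : ∫⁻ σ, f σ ≠ ∞) : ∫⁻ τ in touch I, f (τ.1 - τ.2) ≠ ∞ := by
  have hsub : touch I ⊆ I ×ˢ univ ∪ univ ×ˢ I := by
    rintro z (h | h)
    · exact Or.inl ⟨h, trivial⟩
    · exact Or.inr ⟨trivial, h⟩
  refine ne_top_of_le_ne_top ?_ ((lintegral_mono_set hsub).trans (lintegral_union_le _ _ _))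
  rw [setLIntegral_prod_univ_sub hf, setLIntegral_univ_prod_sub hf]
  exact ENNReal.add_ne_top.2 ⟨ENNReal.mul_ne_top hI hfin, ENNReal.mul_ne_top hI hfin⟩

/-- The energy of a set dominates the integral of the energies of its slices. -/
lemma setLIntegral_slice_self_le {n : ℕ} {s : ℝ} (hs0 : 0 < s)
    {B : Set (EuclideanSpace ℝ (Fin n))} {I : Set ℝ}
    {G : Set (EuclideanSpace ℝ (Fin (n + 1)))} (hB : MeasurableSet B) (hBfin : volume B ≠ ∞)
    (hI : MeasurableSet I) (hG : MeasurableSet G)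
    (hslice : ∀ t t', slice n G t ∩ Bᶜ = slice n G t' ∩ Bᶜ) :
    ∫⁻ τ in touch I, sliceEnergy n s B (τ.1 - τ.2) (slice n G τ.1) (slice n G τ.1) ≤
      ∫⁻ τ in touch I, sliceEnergy n s B (τ.1 - τ.2) (slice n G τ.1) (slice n G τ.2) := by
  have hIm := measurableSet_touch hI
  have meas {g h : ℝ × ℝ → ℝ} (hg : Measurable g) (hh : Measurable h) :=
    measurable_sliceEnergy_slice (s := s) (f := fun τ => τ.1 - τ.2) hB hG hG
      (by fun_prop) hg hh
  have hpre : Prod.swap ⁻¹' (touch I) = touch I := by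
    ext z; simp [touch, or_comm]
  have e1 : ∫⁻ τ in touch I, sliceEnergy n s B (τ.1 - τ.2) (slice n G τ.1) (slice n G τ.1) =
      ∫⁻ τ in touch I, sliceEnergy n s B (τ.1 - τ.2) (slice n G τ.2) (slice n G τ.2) := by
    rw [setLIntegral_swap (meas measurable_fst measurable_fst) hIm, hpre]
    refine lintegral_congr fun τ => ?_
    rw [← sliceEnergy_neg]; simp
  have e2 : ∫⁻ τ in touch I, sliceEnergy n s B (τ.1 - τ.2) (slice n G τ.1) (slice n G τ.2) =
      ∫⁻ τ in touch I, sliceEnergy n s B (τ.1 - τ.2) (slice n G τ.2) (slice n G τ.1) := by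
    rw [setLIntegral_swap (meas measurable_fst measurable_snd) hIm, hpre]
    refine lintegral_congr fun τ => ?_
    rw [← sliceEnergy_neg]; simp
  -- Doubling symmetrizes both sides under exchange of heights, so `sliceEnergy_add_le` applies
  -- pointwise off the null diagonal.
  have h2 : 2 * ∫⁻ τ in touch I, sliceEnergy n s B (τ.1 - τ.2) (slice n G τ.1) (slice n G τ.1) ≤
      2 * ∫⁻ τ in touch I, sliceEnergy n s B (τ.1 - τ.2) (slice n G τ.1) (slice n G τ.2) := by
    rw [two_mul, two_mul]
    nth_rewrite 2 [e1]
    nth_rewrite 2 [e2]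
    rw [← lintegral_add_left (meas measurable_fst measurable_fst),
      ← lintegral_add_left (meas measurable_fst measurable_snd)]
    refine lintegral_mono_ae (ae_restrict_of_ae ?_)
    filter_upwards [ae_fst_ne_snd] with τ hτ
    exact sliceEnergy_add_le n hs0 (sub_ne_zero.2 hτ) hB hBfin (measurableSet_slice hG _)
      (measurableSet_slice hG _) (hslice _ _)
  exact (ENNReal.mul_le_mul_iff_right two_ne_zero ENNReal.ofNat_ne_top).1 h2

/-! ### Minimality passes from the base to the cylinder -/

lemma norm_fst_splitLast_le (n : ℕ) (x : EuclideanSpace ℝ (Fin (n + 1))) :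
    ‖(splitLast n x).1‖ ≤ ‖x‖ := by
  have := norm_sq_splitLast n x
  exact le_of_sq_le_sq (by nlinarith [sq_nonneg (splitLast n x).2]) (norm_nonneg _)

lemma abs_snd_splitLast_le (n : ℕ) (x : EuclideanSpace ℝ (Fin (n + 1))) :
    |(splitLast n x).2| ≤ ‖x‖ := by
  have := norm_sq_splitLast n x
  exact abs_le_of_sq_le_sq (by nlinarith [sq_nonneg ‖(splitLast n x).1‖]) (norm_nonneg _)

lemma touch_subset_touchProd {n : ℕ} {D : Set (EuclideanSpace ℝ (Fin (n + 1)))}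
    {B : Set (EuclideanSpace ℝ (Fin n))} {I : Set ℝ}
    (h : ∀ x ∈ D, (splitLast n x).1 ∈ B ∧ (splitLast n x).2 ∈ I) :
    touch D ⊆ touchProd n B I := by
  rintro z (hz | hz)
  · exact ⟨Or.inl (h _ hz).1, Or.inl (h _ hz).2⟩
  · exact ⟨Or.inr (h _ hz).1, Or.inr (h _ hz).2⟩

lemma IsLocalMinimizer.prodLine {n : ℕ} {s : ℝ} (hs0 : 0 < s) (hs1 : s < 1)
    {E : Set (EuclideanSpace ℝ (Fin n))} (hE : MeasurableSet E) (h : IsLocalMinimizer n s E) :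
    IsLocalMinimizer (n + 1) s (prodLine n E) := by
  intro R hR
  rw [isMinimizer_iff measurableSet_ball (measurableSet_prodLine hE)]
  intro F hF hFE
  have hmin := h R hR
  have hfinE := hmin.energyOn_ball_ne_top hs0 hs1 hR hE
  rw [isMinimizer_iff measurableSet_ball hE] at hmin
  obtain ⟨c, hc0, hct, hc⟩ := exists_lintegral_sliceKern_eq n hs0
  set B := Metric.ball (0 : EuclideanSpace ℝ (Fin n)) R with hBdef
  set I := Ioo (-R) R with hIdef
  have hB : MeasurableSet B := measurableSet_ball
  have hI : MeasurableSet I := measurableSet_Ioo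
  have hmem : ∀ x t, (x ∉ B ∨ t ∉ I) → (x ∈ slice n F t ↔ x ∈ E) := by
    intro x t hxt
    have hnot : (splitLast n).symm (x, t) ∉ Metric.ball 0 R := by
      rw [mem_ball_zero_iff]
      intro hlt
      have h1 := norm_fst_splitLast_le n ((splitLast n).symm (x, t))
      have h2 := abs_snd_splitLast_le n ((splitLast n).symm (x, t))
      rw [MeasurableEquiv.apply_symm_apply] at h1 h2
      rcases hxt with hx | ht
      · exact hx (mem_ball_zero_iff.2 (h1.trans_lt hlt))
      · exact ht (abs_lt.1 (h2.trans_lt hlt))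
    have := Set.ext_iff.1 hFE ((splitLast n).symm (x, t))
    simp only [mem_inter_iff, mem_compl_iff, hnot, not_false_eq_true, and_true] at this
    rw [← slice_prodLine n E t]
    exact this
  have hsl : ∀ t, slice n F t ∩ Bᶜ = E ∩ Bᶜ := by
    intro t; ext x
    simp only [mem_inter_iff, mem_compl_iff, and_congr_left_iff]
    exact fun hx => hmem x t (Or.inl hx)
  have hsub : touch (Metric.ball 0 R) ⊆ touchProd n B I := by
    refine touch_subset_touchProd fun x hx => ?_
    rw [mem_ball_zero_iff] at hx
    exact ⟨mem_ball_zero_iff.2 ((norm_fst_splitLast_le n x).trans_lt hx),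
      abs_lt.1 ((abs_snd_splitLast_le n x).trans_lt hx)⟩
  -- The ball is replaced by the product region `touchProd`, on which the energy splits into slices.
  refine energyOn_le_of_energyOn_le measurableSet_ball hFE subset_rfl hsub ?_ ?_
  · rw [energyOn_touchProd hB hI (measurableSet_prodLine hE)]
    simp only [slice_prodLine]
    refine setLIntegral_touch_sub_ne_top (f := fun σ => sliceEnergy n s B σ E E) (by fun_prop)
      (by simp [hIdef]) ?_
    rw [lintegral_sliceEnergy_self hct hc hB hE]
    exact ENNReal.mul_ne_top hct hfinE
  · rw [energyOn_touchProd hB hI (measurableSet_prodLine hE), energyOn_touchProd hB hI hF]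
    refine le_trans ?_ (setLIntegral_slice_self_le hs0 hB measure_ball_lt_top.ne hI hF
      fun t t' => (hsl t).trans (hsl t').symm)
    simp only [slice_prodLine]
    have hIm := measurableSet_touch hI
    rw [← lintegral_indicator hIm, ← lintegral_indicator hIm, Measure.volume_eq_prod,
      lintegral_prod _ (Measurable.indicator (by fun_prop) hIm).aemeasurable,
      lintegral_prod _ (Measurable.indicator (measurable_sliceEnergy_slice hB hF hF
        (by fun_prop) (by fun_prop) (by fun_prop)) hIm).aemeasurable]
    refine lintegral_mono fun t => ?_
    -- For `t ∈ I` all heights `t'` are admitted, so the inner integral is `c` times an energy in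
    -- `ℝⁿ`. For other `t` the slice is `E` itself.
    by_cases ht : t ∈ I
    · have hmem : ∀ t', (t, t') ∈ touch I := fun t' => Or.inl ht
      simp only [indicator_of_mem (hmem _)]
      rw [lintegral_sub_left_eq_self (fun σ => sliceEnergy n s B σ E E),
        lintegral_sub_left_eq_self (fun σ => sliceEnergy n s B σ (slice n F t) (slice n F t)),
        lintegral_sliceEnergy_self hct hc hB hE,
        lintegral_sliceEnergy_self hct hc hB (measurableSet_slice hF t)]
      gcongr
      exact hmin _ (measurableSet_slice hF t) (hsl t)
    · have : slice n F t = E := by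
        ext x; exact hmem x t (Or.inr ht)
      simp [indicator, this]

/-! ### Minimality passes from the cylinder to the base -/

lemma setLIntegral_prod_compl_sub_le {f : ℝ → ℝ≥0∞} (hf : Measurable f) (L : ℝ) :
    ∫⁻ τ in Ioo (-L) L ×ˢ (Ioo (-L) L)ᶜ, f (τ.1 - τ.2) ≤
      ∫⁻ σ, f σ * ENNReal.ofReal (min |σ| (2 * L)) := by
  have hI : MeasurableSet (Ioo (-L) L) := measurableSet_Ioo
  have hm : MeasurableSet {q : ℝ × ℝ | q.1 ∈ Ioo (-L) L ∧ q.1 - q.2 ∈ (Ioo (-L) L)ᶜ} :=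
    (measurable_fst hI).inter ((measurable_fst.sub measurable_snd) hI.compl)
  rw [← lintegral_indicator (hI.prod hI.compl), Measure.volume_eq_prod,
    lintegral_prod _ (Measurable.indicator (by fun_prop) (hI.prod hI.compl)).aemeasurable]
  have e : ∀ t, ∫⁻ t', (Ioo (-L) L ×ˢ (Ioo (-L) L)ᶜ).indicator
      (fun τ : ℝ × ℝ => f (τ.1 - τ.2)) (t, t') =
      ∫⁻ σ, {q : ℝ × ℝ | q.1 ∈ Ioo (-L) L ∧ q.1 - q.2 ∈ (Ioo (-L) L)ᶜ}.indicator
        (fun q => f q.2) (t, σ) := by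
    intro t
    refine (lintegral_sub_left_eq_self _ t).symm.trans (lintegral_congr fun σ => ?_)
    simp [indicator]
  simp_rw [e]
  rw [lintegral_lintegral_swap (by
    exact (Measurable.indicator (by fun_prop) hm).aemeasurable)]
  refine lintegral_mono fun σ => ?_
  have e2 : ∀ t, {q : ℝ × ℝ | q.1 ∈ Ioo (-L) L ∧ q.1 - q.2 ∈ (Ioo (-L) L)ᶜ}.indicator
        (fun q => f q.2) (t, σ) =
      {t | t ∈ Ioo (-L) L ∧ t - σ ∈ (Ioo (-L) L)ᶜ}.indicator (fun _ => f σ) t := fun t => rfl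
  simp_rw [e2]
  have hσ : MeasurableSet {t : ℝ | t ∈ Ioo (-L) L ∧ t - σ ∈ (Ioo (-L) L)ᶜ} :=
    hI.inter ((measurable_id.sub_const σ) hI.compl)
  rw [lintegral_indicator_const hσ]
  gcongr
  rw [ENNReal.ofReal_mono.map_min]
  refine le_min ?_ ?_
  · rcases le_total 0 σ with h | h
    · have : {t | t ∈ Ioo (-L) L ∧ t - σ ∈ (Ioo (-L) L)ᶜ} ⊆ Ioc (-L) (-L + σ) := by
        rintro t ⟨⟨h1, h2⟩, h3⟩
        refine ⟨h1, ?_⟩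
        by_contra h4
        exact h3 ⟨by linarith, by linarith⟩
      refine (measure_mono this).trans ?_
      rw [Real.volume_Ioc, abs_of_nonneg h]
      gcongr; linarith
    · have : {t | t ∈ Ioo (-L) L ∧ t - σ ∈ (Ioo (-L) L)ᶜ} ⊆ Ico (L + σ) L := by
        rintro t ⟨⟨h1, h2⟩, h3⟩
        refine ⟨?_, h2⟩
        by_contra h4
        exact h3 ⟨by linarith, by linarith⟩
      refine (measure_mono this).trans ?_
      rw [Real.volume_Ico, abs_of_nonpos h]
      gcongr; linarith
  · refine (measure_mono fun t ht => ht.1).trans ?_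
    change volume (Ioo (-L) L) ≤ _
    rw [Real.volume_Ioo]
    gcongr; linarith

lemma tendsto_lintegral_mul_min_div {f : ℝ → ℝ≥0∞} (hf : Measurable f)
    (hfin : ∫⁻ σ, f σ * ENNReal.ofReal (min |σ| 1) ≠ ∞) :
    Tendsto (fun k : ℕ => ∫⁻ σ, f σ * ENNReal.ofReal (min (|σ| / (2 * ((k : ℝ) + 1))) 1))
      atTop (𝓝 0) := by
  rw [← lintegral_zero (α := ℝ) (μ := volume)]
  refine tendsto_lintegral_of_dominated_convergence
    (fun σ => f σ * ENNReal.ofReal (min |σ| 1)) (fun k => by fun_prop) (fun k => ?_) hfin ?_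
  -- The half-length `k + 1` keeps the divisor at least one, so `min(|σ|, 1)` dominates for every
  -- `k`.
  · refine Eventually.of_forall fun σ => ?_
    dsimp only
    gcongr
    refine div_le_self (abs_nonneg _) ?_
    have : (0 : ℝ) ≤ k := k.cast_nonneg
    linarith
  · have h0 : ∀ᵐ σ : ℝ, σ ≠ 0 := by simp [ae_iff]
    filter_upwards [ae_lt_top (by fun_prop) hfin, h0] with σ hσ hσ0
    have hft : f σ ≠ ∞ := by
      intro htop
      rw [htop, ENNReal.top_mul] at hσ
      · exact lt_irrefl _ hσ
      · have : 0 < min |σ| 1 := lt_min (abs_pos.2 hσ0) one_pos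
        simpa using hσ0
    rw [← mul_zero (f σ)]
    refine ENNReal.Tendsto.const_mul ?_ (Or.inr hft)
    rw [← ENNReal.ofReal_zero]
    refine ENNReal.tendsto_ofReal ?_
    have h1 : Tendsto (fun k : ℕ => |σ| / (2 * ((k : ℝ) + 1))) atTop (𝓝 0) := by
      refine Tendsto.div_atTop tendsto_const_nhds ?_
      exact (tendsto_atTop_add_const_right _ _ tendsto_natCast_atTop_atTop).const_mul_atTop
        two_pos
    have h2 := h1.min (tendsto_const_nhds (x := (1 : ℝ)))
    simpa using h2

/-- The set equal to the cylinder over `F` at heights in `I` and over `E` at other heights. -/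
def insertSlab (n : ℕ) (E F : Set (EuclideanSpace ℝ (Fin n))) (I : Set ℝ) :
    Set (EuclideanSpace ℝ (Fin (n + 1))) :=
  splitLast n ⁻¹' (F ×ˢ I ∪ E ×ˢ Iᶜ)

lemma slice_insertSlab_of_mem {n : ℕ} {E F : Set (EuclideanSpace ℝ (Fin n))} {I : Set ℝ} {t : ℝ}
    (ht : t ∈ I) : slice n (insertSlab n E F I) t = F := by
  ext x; simp [slice, insertSlab, ht]

lemma slice_insertSlab_of_notMem {n : ℕ} {E F : Set (EuclideanSpace ℝ (Fin n))} {I : Set ℝ}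
    {t : ℝ} (ht : t ∉ I) : slice n (insertSlab n E F I) t = E := by
  ext x; simp [slice, insertSlab, ht]

lemma measurableSet_insertSlab {n : ℕ} {E F : Set (EuclideanSpace ℝ (Fin n))} {I : Set ℝ}
    (hE : MeasurableSet E) (hF : MeasurableSet F) (hI : MeasurableSet I) :
    MeasurableSet (insertSlab n E F I) :=
  (splitLast n).measurable ((hF.prod hI).union (hE.prod hI.compl))

lemma energyOn_insertSlab_le {n : ℕ} {s : ℝ} {B E F : Set (EuclideanSpace ℝ (Fin n))}
    {I : Set ℝ} (hB : MeasurableSet B) (hE : MeasurableSet E) (hF : MeasurableSet F)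
    (hI : MeasurableSet I) (hEF : F ∩ Bᶜ = E ∩ Bᶜ) :
    energyOn (fun z => kern (n + 1) s (z.1 - z.2)) (touchProd n B I)
        (insertSlab n E F I) (insertSlab n E F I) ≤
      volume I * (∫⁻ σ, sliceEnergy n s B σ F F) +
        2 * ∫⁻ τ in I ×ˢ Iᶜ, (sliceEnergy n s B (τ.1 - τ.2) F F +
          volume B * ∫⁻ h, sliceKern n s (τ.1 - τ.2) h) := by
  set φ : ℝ → ℝ≥0∞ := fun σ => sliceEnergy n s B σ F F + volume B * ∫⁻ h, sliceKern n s σ h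
    with hφ
  have hφm : Measurable φ := by
    have : Measurable fun σ => ∫⁻ h, sliceKern n s σ h :=
      Measurable.lintegral_prod_right' (f := fun q : ℝ × EuclideanSpace ℝ (Fin n) =>
        sliceKern n s q.1 q.2) (by fun_prop)
    fun_prop
  have hswap : ∫⁻ τ in Iᶜ ×ˢ I, φ (τ.1 - τ.2) = ∫⁻ τ in I ×ˢ Iᶜ, φ (τ.1 - τ.2) := by
    rw [setLIntegral_swap (by fun_prop) (hI.compl.prod hI), preimage_swap_prod]
    refine lintegral_congr fun τ => ?_
    have : ∀ σ, φ (-σ) = φ σ := fun σ => by simp [hφ, sliceEnergy_neg, sliceKern_neg_left]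
    rw [← this]; simp
  rw [energyOn_touchProd hB hI (measurableSet_insertSlab hE hF hI)]
  have hsub : touch I ⊆ I ×ˢ I ∪ (I ×ˢ Iᶜ ∪ Iᶜ ×ˢ I) := by
    intro z hz
    simp only [touch, mem_ofPred_eq, mem_union, mem_prod, mem_compl_iff] at hz ⊢
    tauto
  refine (lintegral_mono_set hsub).trans ((lintegral_union_le _ _ _).trans (add_le_add ?_
    ((lintegral_union_le _ _ _).trans ?_)))
  · rw [← setLIntegral_prod_univ_sub (f := fun σ => sliceEnergy n s B σ F F) (by fun_prop)]
    rw [setLIntegral_congr_fun (hI.prod hI)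
      (g := fun τ => sliceEnergy n s B (τ.1 - τ.2) F F) fun τ hτ => by
        simp only [slice_insertSlab_of_mem hτ.1, slice_insertSlab_of_mem hτ.2]]
    exact lintegral_mono_set (prod_mono_right (subset_univ _))
  · rw [two_mul]
    nth_rewrite 2 [← hswap]
    refine add_le_add ?_ ?_
    · refine setLIntegral_mono' (hI.prod hI.compl) fun τ hτ => ?_
      rw [slice_insertSlab_of_mem hτ.1, slice_insertSlab_of_notMem hτ.2]
      exact sliceEnergy_left_le n s _ hEF
    · refine setLIntegral_mono' (hI.compl.prod hI) fun τ hτ => ?_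
      rw [slice_insertSlab_of_notMem hτ.1, slice_insertSlab_of_mem hτ.2]
      exact sliceEnergy_right_le n s _ hEF

lemma le_energyOn_prodLine {n : ℕ} {s : ℝ} {B E : Set (EuclideanSpace ℝ (Fin n))}
    {I : Set ℝ} (hB : MeasurableSet B) (hE : MeasurableSet E) (hI : MeasurableSet I) :
    volume I * (∫⁻ σ, sliceEnergy n s B σ E E) ≤
      energyOn (fun z => kern (n + 1) s (z.1 - z.2)) (touchProd n B I)
        (prodLine n E) (prodLine n E) := by
  rw [energyOn_touchProd hB hI (measurableSet_prodLine hE),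
    ← setLIntegral_prod_univ_sub (f := fun σ => sliceEnergy n s B σ E E) (by fun_prop)]
  simp only [slice_prodLine]
  exact lintegral_mono_set fun z hz => Or.inl hz.1

/-- The modification lives in the cylinder `D` of radius `R` and half-height `L`, contained in the
ball of radius `R + L`. Minimality there is transferred to the product region, since both sets of
pairs contain `touch D`. -/
lemma energyOn_prodLine_le_insertSlab {n : ℕ} {s : ℝ} (hs0 : 0 < s) (hs1 : s < 1)
    {E F : Set (EuclideanSpace ℝ (Fin n))} (hE : MeasurableSet E) (hF : MeasurableSet F)
    (h : IsLocalMinimizer (n + 1) s (prodLine n E)) {R L : ℝ} (hR : 0 < R) (hL : 0 < L)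
    (hFE : F ∩ (Metric.ball 0 R)ᶜ = E ∩ (Metric.ball 0 R)ᶜ) :
    energyOn (fun z => kern (n + 1) s (z.1 - z.2)) (touchProd n (Metric.ball 0 R) (Ioo (-L) L))
        (prodLine n E) (prodLine n E) ≤
      energyOn (fun z => kern (n + 1) s (z.1 - z.2)) (touchProd n (Metric.ball 0 R) (Ioo (-L) L))
        (insertSlab n E F (Ioo (-L) L)) (insertSlab n E F (Ioo (-L) L)) := by
  have hRL : 0 < R + L := by linarith
  have hP := measurableSet_prodLine hE
  have hmin := h (R + L) hRL
  have hfin := hmin.energyOn_ball_ne_top hs0 hs1 hRL hP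
  rw [isMinimizer_iff measurableSet_ball hP] at hmin
  set D := splitLast n ⁻¹' (Metric.ball 0 R ×ˢ Ioo (-L) L) with hDdef
  have hD : MeasurableSet D := (splitLast n).measurable (measurableSet_ball.prod measurableSet_Ioo)
  have hDsub : D ⊆ Metric.ball 0 (R + L) := by
    rintro x ⟨h1, h2⟩
    rw [mem_ball_zero_iff] at h1 ⊢
    have h3 := norm_sq_splitLast n x
    have h4 := abs_lt.2 h2
    refine lt_of_pow_lt_pow_left₀ 2 hRL.le ?_
    rw [← h3, ← sq_abs (splitLast n x).2]
    nlinarith [norm_nonneg (splitLast n x).1, abs_nonneg (splitLast n x).2]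
  have hagree : insertSlab n E F (Ioo (-L) L) ∩ Dᶜ = prodLine n E ∩ Dᶜ := by
    ext x
    have := Set.ext_iff.1 hFE (splitLast n x).1
    simp only [insertSlab, prodLine_eq, hDdef, mem_inter_iff, mem_preimage, mem_union, mem_prod,
      mem_compl_iff, mem_univ, and_true] at this ⊢
    tauto
  refine energyOn_le_of_energyOn_le hD hagree
    (touch_subset_touchProd fun x hx => ⟨hx.1, hx.2⟩)
    (Q := touch (Metric.ball 0 (R + L))) ?_ hfin
    (hmin _ (measurableSet_insertSlab hE hF measurableSet_Ioo) ?_)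
  · rintro z (hz | hz)
    · exact Or.inl (hDsub hz)
    · exact Or.inr (hDsub hz)
  · ext x
    have := Set.ext_iff.1 hagree x
    have hx := @hDsub x
    simp only [mem_inter_iff, mem_compl_iff] at this ⊢
    tauto

lemma IsLocalMinimizer.of_prodLine {n : ℕ} {s : ℝ} (hs0 : 0 < s) (hs1 : s < 1)
    {E : Set (EuclideanSpace ℝ (Fin n))} (hE : MeasurableSet E)
    (h : IsLocalMinimizer (n + 1) s (FracPerimeter.prodLine n E)) : IsLocalMinimizer n s E := by
  intro R hR
  rw [isMinimizer_iff measurableSet_ball hE]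
  intro F hF hFE
  set B := Metric.ball (0 : EuclideanSpace ℝ (Fin n)) R with hBdef
  have hB : MeasurableSet B := measurableSet_ball
  have hBfin : volume B ≠ ∞ := measure_ball_lt_top.ne
  obtain ⟨c, hc0, hct, hc⟩ := exists_lintegral_sliceKern_eq n hs0
  by_cases hFfin : energyOn (fun z => kern n s (z.1 - z.2)) (touch B) F F = ∞
  -- Only competitors of finite energy remain; this makes `φ` integrable against `min(|σ|, 1)`.
  · rw [hFfin]; exact le_top
  rw [← ENNReal.mul_le_mul_iff_right hc0 hct, ← lintegral_sliceEnergy_self hct hc hB hE,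
    ← lintegral_sliceEnergy_self hct hc hB hF]
  set φ : ℝ → ℝ≥0∞ := fun σ => sliceEnergy n s B σ F F + volume B * ∫⁻ h, sliceKern n s σ h
    with hφ
  have hκm : Measurable fun σ => ∫⁻ h, sliceKern n s σ h :=
      Measurable.lintegral_prod_right' (f := fun q : ℝ × EuclideanSpace ℝ (Fin n) =>
        sliceKern n s q.1 q.2) (by fun_prop)
  have hφm : Measurable φ := by fun_prop
  have hφfin : ∫⁻ σ, φ σ * ENNReal.ofReal (min |σ| 1) ≠ ∞ := by
    have hle : ∀ σ, φ σ * ENNReal.ofReal (min |σ| 1) ≤ sliceEnergy n s B σ F F +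
        volume B * (ENNReal.ofReal (min |σ| 1) * ∫⁻ h, sliceKern n s σ h) := by
      intro σ
      rw [hφ, add_mul, mul_assoc, mul_comm (∫⁻ h, sliceKern n s σ h)]
      gcongr
      exact mul_le_of_le_one_right' (ENNReal.ofReal_le_one.2 (min_le_right _ _))
    refine ne_top_of_le_ne_top ?_ (lintegral_mono hle)
    rw [lintegral_add_left (by fun_prop), lintegral_const_mul' _ _ hBfin,
      lintegral_sliceEnergy_self hct hc hB hF]
    exact ENNReal.add_ne_top.2 ⟨ENNReal.mul_ne_top hct hFfin,
      ENNReal.mul_ne_top hBfin (lintegral_min_mul_lintegral_sliceKern_lt_top n hs0 hs1).ne⟩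
  -- The slab inequality with `L = k + 1`, divided by the slab height `2L`.
  have hbound : ∀ k : ℕ, ∫⁻ σ, sliceEnergy n s B σ E E ≤ (∫⁻ σ, sliceEnergy n s B σ F F) +
      2 * ∫⁻ σ, φ σ * ENNReal.ofReal (min (|σ| / (2 * ((k : ℝ) + 1))) 1) := by
    intro k
    set L : ℝ := (k : ℝ) + 1 with hLdef
    have hL : 0 < L := by positivity
    have h2L : 0 < 2 * L := by positivity
    have hvol : volume (Ioo (-L) L) = ENNReal.ofReal (2 * L) := by
      rw [Real.volume_Ioo]; congr 1; ring
    have h1 := (le_energyOn_prodLine (s := s) hB hE measurableSet_Ioo).trans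
      ((energyOn_prodLine_le_insertSlab hs0 hs1 hE hF h hR hL hFE).trans
        (energyOn_insertSlab_le hB hE hF measurableSet_Ioo hFE))
    have h2 := setLIntegral_prod_compl_sub_le hφm L
    have h3 : ∫⁻ σ, φ σ * ENNReal.ofReal (min |σ| (2 * L)) =
        ENNReal.ofReal (2 * L) * ∫⁻ σ, φ σ * ENNReal.ofReal (min (|σ| / (2 * L)) 1) := by
      rw [← lintegral_const_mul' _ _ ENNReal.ofReal_ne_top]
      refine lintegral_congr fun σ => ?_
      rw [mul_left_comm, ← ENNReal.ofReal_mul h2L.le, mul_min_of_nonneg _ _ h2L.le,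
        mul_div_cancel₀ _ h2L.ne', mul_one]
    rw [h3] at h2
    rw [hvol] at h1
    have h4 : ENNReal.ofReal (2 * L) * ∫⁻ σ, sliceEnergy n s B σ E E ≤ ENNReal.ofReal (2 * L) *
        ((∫⁻ σ, sliceEnergy n s B σ F F) +
          2 * ∫⁻ σ, φ σ * ENNReal.ofReal (min (|σ| / (2 * L)) 1)) := by
      rw [mul_add (ENNReal.ofReal _), mul_left_comm (ENNReal.ofReal _)]
      refine h1.trans (add_le_add le_rfl (mul_le_mul_right h2 2))
    exact (ENNReal.mul_le_mul_iff_right (ENNReal.ofReal_pos.2 h2L).ne' ENNReal.ofReal_ne_top).1 h4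
  have hlim : Tendsto (fun k : ℕ => (∫⁻ σ, sliceEnergy n s B σ F F) +
      2 * ∫⁻ σ, φ σ * ENNReal.ofReal (min (|σ| / (2 * ((k : ℝ) + 1))) 1)) atTop
      (𝓝 ((∫⁻ σ, sliceEnergy n s B σ F F) + 2 * 0)) :=
    tendsto_const_nhds.add (ENNReal.Tendsto.const_mul
      (tendsto_lintegral_mul_min_div hφm hφfin) (Or.inr ENNReal.ofNat_ne_top))
  rw [mul_zero, add_zero] at hlim
  exact ge_of_tendsto' hlim hbound

lemma prodLine_congr {n : ℕ} {E E' : Set (EuclideanSpace ℝ (Fin n))} (h : E =ᵐ[volume] E') :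
    prodLine n E =ᵐ[volume] prodLine n E' := by
  rw [prodLine_eq, prodLine_eq]
  exact (measurePreserving_splitLast n).quasiMeasurePreserving.preimage_ae_eq
    (Measure.set_prod_ae_eq h (ae_eq_refl _))

end FracPerimeter

theorem mainTheorem10 (n : ℕ) (s : ℝ) (hs0 : 0 < s) (hs1 : s < 1)
    (E : Set (EuclideanSpace ℝ (Fin n))) (hE : NullMeasurableSet E volume) :
    FracPerimeter.IsLocalMinimizer n s E ↔
      FracPerimeter.IsLocalMinimizer (n + 1) s (FracPerimeter.prodLine n E) := by
  have hE' := measurableSet_toMeasurable volume E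
  have hae := hE.toMeasurable_ae_eq
  rw [← FracPerimeter.isLocalMinimizer_congr hE'.nullMeasurableSet hae,
    ← FracPerimeter.isLocalMinimizer_congr
      (FracPerimeter.measurableSet_prodLine hE').nullMeasurableSet
      (FracPerimeter.prodLine_congr hae)]
  exact ⟨fun h => h.prodLine hs0 hs1 hE', fun h => h.of_prodLine hs0 hs1 hE'⟩
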